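/- **Setting.** Let $T$ be $\mathbb R^d$ or $\mathbb Z^d$, $d\ge 1$, with its Borel $\sigma$-field (more generally, any measurable space). Let $Z(t)$, $t\in T$, be a random process with values in $[-\infty,\infty)$ and $\mathbb E\,e^{Z(t)}=1$ for all $t\in T$, and let $$\zeta_Z(t)=\max_{i\ge1}\bigl(P_i+Z_i(t)\bigr),\qquad t\in T,$$ where $\sum_i\varepsilon_{P_i}$ is a Poisson point process on $\mathbb R$ with intensity $e^{-p}\,dp$ and the $Z_i$ are independent copies of $Z$, independent of $(P_i)_i$. (Here and below, $\max$ denotes the supremum in $[-\infty,\infty]$.) For $h\in T$ let $Z^{[h]}$ be the exponential tilt of $Z$ by $Z(h)$, that is, a process with law $\mathbb P(Z^{[h]}\in A)=\mathbb E\bigl(e^{Z(h)}\mathbb 1\{Z\in A\}\bigr)$ for $A$ in the $\sigma$-field generated by the evaluation maps, and let $\Xi_hZ(t)=Z^{[h]}(t)-Z^{[h]}(h)$. For distinct $t_1,\dots,t_n\in T$ let $H(x)=\mathbb P(\zeta_Z(t_k)\le x_k,\ 1\le k\le n)$ and $$G(x)=\frac1{\ln H(0)}\,\ln\frac{H(\min(x_1,0),\dots,\min(x_n,0))}{H(x)},\qquad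 x\in\mathbb R^n .$$ **Theorem.** (i) Suppose that $\mathbb P(Z(h)>-\infty)=1$ for some $h\in T$, and let $t_1=h,t_2,\dots,t_n\in T$ be distinct. Then $G$ is the distribution function of a random vector with values in $[-\infty,\infty]^n$, and for every random vector $W=(W_1,\dots,W_n)$ with distribution function $G$ (that is, $\mathbb P(W_k\le x_k,\ 1\le k\le n)=G(x)$ for all $x\in\mathbb R^n$), denoting by $W^{(h)}=(W^{(h)}_1,\dots,W^{(h)}_n)$ a vector with the conditional law of $W$ given $W_1>0$, $$\bigl(\Xi_hZ(t_2),\dots,\Xi_hZ(t_n)\bigr)\stackrel{d}{=}\bigl(W^{(h)}_2-W^{(h)}_1,\dots,W^{(h)}_n-W^{(h)}_1\bigr).$$ Consequently the law of $\Xi_hZ$ is determined by $\zeta_Z$: if $Y$ is another process with values in $[-\infty,\infty)$ with $\mathbb E\,e^{Y(t)}=1$ for all $t\in T$ and $\mathbb P(Y(h)>-\infty)=1$, and if $\zeta_Y$ and $\zeta_Z$ have the same finite-dimensional distributions, then $\Xi_hY$ and $\Xi_hZ$ have the same law. (ii) Suppose that $\mathbb P(Z(h)>-\infty)=1$ for every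 $h\in T$ and that $Z$ is a measurable process (jointly measurable in $(\omega,t)$). Let $\mu$ be a non-zero $\sigma$-finite measure on $T$ such that $\int_T e^{Z(s)}\,\mu(ds)<\infty$ almost surely. Let $(P_i,T_i)$, $i\ge1$, be the points of a Poisson point process on $\mathbb R\times T$ with intensity $e^{-p}\,dp\cdot\mu(dt)$, and let $\Xi_{T_i}Z_i$, $i\ge1$, be measurable processes which, given $(P_j,T_j)_{j\ge1}$, are independent, $\Xi_{T_i}Z_i$ having the law of $\Xi_hZ$ with $h=T_i$. Then the processes $\zeta_Z$ and $$t\mapsto\max_{i\ge1}\Bigl(P_i+\Xi_{T_i}Z_i(t)-\ln\int_T e^{\Xi_{T_i}Z_i(s)}\,\mu(ds)\Bigr),\qquad t\in T,$$ have the same finite-dimensional distributions. -/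

import Mathlib

open MeasureTheory ProbabilityTheory
open scoped ENNReal

namespace MaxStable

noncomputable section

/-- A spectral process: a random process `Z(t)`, `t ∈ T`, with values in `[-∞, ∞)` and
`E e^{Z(t)} = 1` for every `t`. Path space `T → EReal` carries the σ-field generated by the
evaluation maps. -/
structure IsSpectralProcess {Ω T : Type*} [MeasurableSpace Ω] (P : Measure Ω)
    (Z : Ω → T → EReal) : Prop where
  measurable : Measurable Z
  ne_top : ∀ ω t, Z ω t ≠ ⊤
  lintegral_exp : ∀ t, ∫⁻ ω, EReal.exp (Z ω t) ∂P = 1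

/-- The number of indices `i` with `ξ i ω ∈ A`, i.e. the mass that the point process
`∑ᵢ ε_{ξ i}` gives to `A`. -/
def pointCount {Ω E : Type*} (ξ : ℕ → Ω → E) (A : Set E) (ω : Ω) : ℕ∞ :=
  {i : ℕ | ξ i ω ∈ A}.encard

/-- The random points `ξ 0, ξ 1, …` are (an enumeration of) the points of a Poisson point process
on `E` with intensity measure `Λ`: `ξ i` are random elements, the number of points in `A` is
Poisson distributed with mean `Λ A` (almost surely infinite if `Λ A = ∞`), and the numbers of
points in disjoint sets are independent. -/
structure IsPoissonPointProcess {Ω E : Type*} [MeasurableSpace Ω] [MeasurableSpace E]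
    (Q : Measure Ω) (ξ : ℕ → Ω → E) (Λ : Measure E) : Prop where
  measurable : ∀ i, Measurable (ξ i)
  count_law : ∀ A, MeasurableSet A → Λ A ≠ ∞ →
    Q.map (pointCount ξ A) = (poissonMeasure (Λ A).toNNReal).map (fun n : ℕ => (n : ℕ∞))
  count_top : ∀ A, MeasurableSet A → Λ A = ∞ → ∀ᵐ ω ∂Q, pointCount ξ A ω = ⊤
  count_indep : ∀ (m : ℕ) (A : Fin m → Set E), (∀ j, MeasurableSet (A j)) →
    Pairwise (fun i j => Disjoint (A i) (A j)) → iIndepFun (fun j => pointCount ξ (A j)) Q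

/-- The measure `e^{-p} dp` on the real line. -/
def gumbelIntensity : Measure ℝ :=
  volume.withDensity (fun p => ENNReal.ofReal (Real.exp (-p)))

/-- The ingredients of the max-stable process associated to `Z`, realised on `(Ω', Q)`: the points
`p i` of a Poisson point process on `ℝ` with intensity `e^{-p} dp`, and independent copies `Zs i`
of `Z`, independent of the points. -/
structure IsSpectralSystem {Ω Ω' T : Type*} [MeasurableSpace Ω] [MeasurableSpace Ω']
    (P : Measure Ω) (Z : Ω → T → EReal) (Q : Measure Ω')
    (p : ℕ → Ω' → ℝ) (Zs : ℕ → Ω' → T → EReal) : Prop where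
  poisson : IsPoissonPointProcess Q p gumbelIntensity
  measurable_copies : ∀ i, Measurable (Zs i)
  copies : ∀ i, IdentDistrib (Zs i) Z Q P
  indep_copies : iIndepFun Zs Q
  indep_points : IndepFun (fun ω i => p i ω) (fun ω i => Zs i ω) Q

/-- The process `ζ(t) = maxᵢ (pᵢ + Zᵢ(t))`. -/
def maxProcess {Ω T : Type*} (p : ℕ → Ω → ℝ) (Zs : ℕ → Ω → T → EReal) (ω : Ω) (t : T) : EReal :=
  ⨆ i, ((p i ω : EReal) + Zs i ω t)

/-- Equality of all finite-dimensional distributions. -/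
def SameFidis {Ω Ω' T : Type*} [MeasurableSpace Ω] [MeasurableSpace Ω']
    (P : Measure Ω) (X : Ω → T → EReal) (Q : Measure Ω') (Y : Ω' → T → EReal) : Prop :=
  ∀ (n : ℕ) (t : Fin n → T),
    IdentDistrib (fun ω k => X ω (t k)) (fun ω k => Y ω (t k)) P Q

/-- The law of the exponential tilt `Z^{[h]}` of `Z` by `Z(h)`:
`P(Z^{[h]} ∈ A) = E (e^{Z(h)} 1{Z ∈ A})`. -/
def tiltLaw {Ω T : Type*} [MeasurableSpace Ω] (P : Measure Ω) (Z : Ω → T → EReal) (h : T) :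
    Measure (T → EReal) :=
  (P.withDensity (fun ω => EReal.exp (Z ω h))).map Z

/-- The law of the tilted spectral process `Ξ_h Z = Z^{[h]} - Z^{[h]}(h)`. -/
def tiltedSpectralLaw {Ω T : Type*} [MeasurableSpace Ω] (P : Measure Ω) (Z : Ω → T → EReal)
    (h : T) : Measure (T → EReal) :=
  (tiltLaw P Z h).map (fun f t => f t - f h)

/-- The joint distribution function of `ζ(t_k)`, `k ∈ ι`. -/
def jointDF {Ω T ι : Type*} [MeasurableSpace Ω] (Q : Measure Ω) (ζ : Ω → T → EReal) (t : ι → T)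
    (x : ι → ℝ) : ℝ :=
  Q.real {ω | ∀ k, ζ ω (t k) ≤ (x k : EReal)}

/-- The generalised Pareto distribution function associated to the distribution function `H`:
`G(x) = (1 / ln H(0)) ln (H(min(x, 0)) / H(x))`. -/
def gpdDF {ι : Type*} (H : (ι → ℝ) → ℝ) (x : ι → ℝ) : ℝ :=
  1 / Real.log (H 0) * Real.log (H (fun k => min (x k) 0) / H x)

/-- `W` is a random vector, possibly with components `-∞`, whose distribution function is the
generalised Pareto distribution function associated to `H`. -/
structure IsGPDVector {Ω ι : Type*} [MeasurableSpace Ω] (R : Measure Ω) (W : Ω → ι → EReal)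
    (H : (ι → ℝ) → ℝ) : Prop where
  measurable : Measurable W
  df_eq : ∀ x : ι → ℝ, R.real {ω | ∀ k, W ω k ≤ (x k : EReal)} = gpdDF H x

/-- The ingredients of the Dieker-Mikosch representation, realised on `(Ω', Q)`: the points
`(p i, τ i)` of a Poisson point process on `ℝ × T` with intensity `e^{-p} dp ⋅ μ(dt)`, and
processes `X i = Ξ_{τ i} Z_i`. These are (jointly) measurable processes which, given the sequence
of all points, are independent, `X i` having the law of `Ξ_h Z` with `h = τ i`. -/
structure IsTiltedSystem {Ω Ω' T : Type*} [MeasurableSpace Ω] [MeasurableSpace Ω']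
    [MeasurableSpace T] (P : Measure Ω) (Z : Ω → T → EReal) (μ : Measure T) (Q : Measure Ω')
    (p : ℕ → Ω' → ℝ) (τ : ℕ → Ω' → T) (X : ℕ → Ω' → T → EReal) : Prop where
  poisson : IsPoissonPointProcess Q (fun i ω => (p i ω, τ i ω)) (gumbelIntensity.prod μ)
  measurable_marks : ∀ i, Measurable (fun q : Ω' × T => X i q.1 q.2)
  conditional_law : ∀ (n : ℕ) (B : Set (ℕ → ℝ × T)) (A : ℕ → Set (T → EReal)),
    MeasurableSet B → (∀ i, MeasurableSet (A i)) →
    Q ({ω | (fun i => (p i ω, τ i ω)) ∈ B} ∩ {ω | ∀ i < n, X i ω ∈ A i}) =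
      ∫⁻ ω in {ω | (fun i => (p i ω, τ i ω)) ∈ B},
        ∏ i ∈ Finset.range n, tiltedSpectralLaw P Z (τ i ω) (A i) ∂Q

/-- The process `maxᵢ (pᵢ + Xᵢ(t) - ln ∫ e^{Xᵢ(s)} μ(ds))`. -/
def diekerMikoschProcess {Ω T : Type*} [MeasurableSpace T] (μ : Measure T) (p : ℕ → Ω → ℝ)
    (X : ℕ → Ω → T → EReal) (ω : Ω) (t : T) : EReal :=
  ⨆ i, ((p i ω : EReal) + X i ω t - ENNReal.log (∫⁻ s, EReal.exp (X i ω s) ∂μ))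

end

end MaxStable

/-!
The proof compares void probabilities of Poisson point processes.

The points `(P_i + Z_i(t_k))_k` form a Poisson point process on `[-∞, ∞)^n` whose intensity is the
exponent measure `Λ`, the image of `e^{-p} dp ⊗ P` under `(p, ω) ↦ (p + Z(t_k)(ω))_k`. Hence
`H(x) = e^{-V(x)}`, where `V(x)` is the `Λ`-mass of the complement of the box with upper corner `x`.
Neither Poisson point processes nor their marking theorem are in Mathlib. The Laplace functional
(`IsPoissonPointProcess.laplace`) follows from the independence of the counts for simple functions
and monotone limits; applied to `-ln κ(·, D)` it gives the probability that no marked point lies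
outside `D`, for marks which are conditionally independent with laws `κ(ξ_i)`
(`IsMarking.measure_forall`).

For part (i), `G(x) = (V(min(x, 0)) - V(x)) / V(0)` is the distribution function of `Λ` conditioned
on a positive component (`paretoMeasure`), and a vector with distribution function `G` has this law
because `Λ` has no mass at `+∞`. Conditioning further on `v_1 > 0`, which has `Λ`-mass
`E e^{Z(h)} = 1`, and integrating out `p > -Z(h)` produces the density `e^{Z(h)}` of the tilt, while
the increments `v_k - v_1 = Z(t_k) - Z(h)` do not depend on `p`. The law on path space is then
determined by its finite-dimensional projections.

For part (ii) the marking theorem applies to the points `(P_i, T_i)` with marks `Ξ_{T_i} Z_i`. The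
difficulty is that `f ↦ ∫ e^f dμ` is not measurable for the product σ-field on path space, so that
the conditional law of a mark says nothing directly about its path integral. By the law of large
numbers and Fubini's theorem, for almost every i.i.d. sample of points of `T` the path integral of a
given jointly measurable process is almost surely a fixed functional of its values at the sample
(`sampledIntegral`, `ae_ae_sampledIntegral_eq`); one sample serves for all marks and for the family
`Z - Z(h)`. What remains is a translation of `e^{-p} dp` by `ln ∫ e^Z dμ` and the cancellation
`∫ e^{Z(h)} μ(dh) / ∫ e^Z dμ = 1` (`IsSpectralProcess.lintegral_tilted_normalised`).
-/

namespace MaxStable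

open Filter Topology
open scoped NNReal

/-! ### The Laplace functional of a Poisson point process -/

/-- The function `x ↦ e^{-x}` on `[0, ∞]`, with `e^{-∞} = 0`. -/
noncomputable def expNeg (x : ℝ≥0∞) : ℝ≥0∞ := EReal.exp (-(x : EReal))

@[simp] lemma expNeg_zero : expNeg 0 = 1 := by simp [expNeg]

@[simp] lemma expNeg_top : expNeg ∞ = 0 := by simp [expNeg]

lemma expNeg_eq_inv (x : ℝ≥0∞) : expNeg x = (EReal.exp x)⁻¹ := EReal.exp_neg _

lemma expNeg_add (x y : ℝ≥0∞) : expNeg (x + y) = expNeg x * expNeg y := by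
  rw [expNeg_eq_inv, expNeg_eq_inv, expNeg_eq_inv, EReal.coe_ennreal_add, EReal.exp_add,
    ENNReal.mul_inv] <;> simp

lemma expNeg_sum {ι : Type*} (s : Finset ι) (f : ι → ℝ≥0∞) :
    expNeg (∑ i ∈ s, f i) = ∏ i ∈ s, expNeg (f i) := by
  induction s using Finset.cons_induction with
  | empty => simp
  | cons a s ha ih => rw [Finset.sum_cons, Finset.prod_cons, expNeg_add, ih]

lemma expNeg_mul_natCast (c : ℝ≥0∞) (n : ℕ) : expNeg (c * n) = expNeg c ^ n := by
  have : (c * n : ℝ≥0∞) = ∑ _i ∈ Finset.range n, c := by simp [mul_comm]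
  rw [this, expNeg_sum]
  simp

lemma continuous_expNeg : Continuous expNeg :=
  ENNReal.continuous_exp.comp (continuous_neg.comp continuous_coe_ennreal_ereal)

@[fun_prop]
lemma measurable_expNeg : Measurable expNeg := continuous_expNeg.measurable

lemma expNeg_antitone : Antitone expNeg := fun x y h => by
  simpa [expNeg] using h

lemma expNeg_le_one (x : ℝ≥0∞) : expNeg x ≤ 1 := by
  simpa using expNeg_antitone (zero_le (a := x))

lemma expNeg_eq_ofReal {x : ℝ≥0∞} (hx : x ≠ ∞) :
    expNeg x = ENNReal.ofReal (Real.exp (-x.toReal)) := by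
  lift x to ℝ≥0 using hx
  rw [expNeg, ← EReal.exp_coe]
  rfl

lemma expNeg_lt_one {x : ℝ≥0∞} (hx : x ≠ 0) : expNeg x < 1 := by
  simpa [expNeg, pos_iff_ne_zero] using hx

lemma exists_expNeg_eq {y : ℝ≥0∞} (hy : y ≤ 1) : expNeg (-ENNReal.log y).toENNReal = y := by
  have : (0 : EReal) ≤ -ENNReal.log y := by simpa using hy
  rw [expNeg, EReal.coe_toENNReal this, neg_neg, ENNReal.exp_log]

lemma lintegral_expNeg_poissonMeasure (r : ℝ≥0) (c : ℝ≥0∞) :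
    ∫⁻ n, expNeg (c * (n : ℝ≥0∞)) ∂(poissonMeasure r) = expNeg ((1 - expNeg c) * r) := by
  have h1 := expNeg_le_one c
  simp_rw [expNeg_mul_natCast]
  generalize expNeg c = a at *
  lift a to ℝ≥0 using (h1.trans_lt ENNReal.one_lt_top).ne
  have h1' : a ≤ 1 := by exact_mod_cast h1
  have hs : HasSum (fun n : ℕ => (a : ℝ) ^ n * (Real.exp (-r) * r ^ n / n.factorial))
      (Real.exp (-((1 - a) * r))) := by
    have := (NormedSpace.expSeries_div_hasSum_exp ((a * r : ℝ))).mul_left (Real.exp (-r))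
    rw [← Real.exp_eq_exp_ℝ, ← Real.exp_add] at this
    convert! this using 1
    · ext n; rw [mul_pow]; ring
    · congr 1; ring
  rw [lintegral_countable']
  simp_rw [poissonMeasure_singleton]
  have hx : ((1 - (a : ℝ≥0∞)) * r) = (((1 - a) * r : ℝ≥0) : ℝ≥0∞) := by push_cast; rfl
  rw [hx, expNeg_eq_ofReal ENNReal.coe_ne_top, ENNReal.coe_toReal, NNReal.coe_mul,
    NNReal.coe_sub h1', NNReal.coe_one, ← hs.tsum_eq,
    ENNReal.ofReal_tsum_of_nonneg (fun n => by positivity) hs.summable]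
  congr with n
  rw [ENNReal.ofReal_mul (by positivity), ENNReal.ofReal_pow (by positivity),
    ENNReal.ofReal_coe_nnreal]

lemma coe_pointCount {Ω E : Type*} (ξ : ℕ → Ω → E) (A : Set E) (ω : Ω) :
    (pointCount ξ A ω : ℝ≥0∞) = ∑' i, A.indicator 1 (ξ i ω) := by
  rw [pointCount, ← ENNReal.tsum_set_one, tsum_subtype {i | ξ i ω ∈ A} (fun _ => (1 : ℝ≥0∞))]
  rfl

section Poisson

variable {Ω E : Type*} [MeasurableSpace Ω] [MeasurableSpace E]

lemma measurable_toENNReal_pointCount {ξ : ℕ → Ω → E} (hξ : ∀ i, Measurable (ξ i)) {A : Set E}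
    (hA : MeasurableSet A) : Measurable fun ω => (pointCount ξ A ω : ℝ≥0∞) := by
  simp_rw [coe_pointCount]
  exact Measurable.tsum fun i => (measurable_one.indicator hA).comp (hξ i)

lemma measurable_pointCount {ξ : ℕ → Ω → E} (hξ : ∀ i, Measurable (ξ i)) {A : Set E}
    (hA : MeasurableSet A) : Measurable (pointCount ξ A) := by
  refine measurable_to_countable' fun n => ?_
  have : pointCount ξ A ⁻¹' {n} = (fun ω => (pointCount ξ A ω : ℝ≥0∞)) ⁻¹' {(n : ℝ≥0∞)} := by
    ext ω
    simp
  rw [this]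
  exact measurable_toENNReal_pointCount hξ hA (measurableSet_singleton _)

lemma IsPoissonPointProcess.lintegral_expNeg_pointCount {Q : Measure Ω} [IsProbabilityMeasure Q]
    {ξ : ℕ → Ω → E} {Λ : Measure E} (h : IsPoissonPointProcess Q ξ Λ) {A : Set E}
    (hA : MeasurableSet A) (c : ℝ≥0∞) :
    ∫⁻ ω, expNeg (c * (pointCount ξ A ω : ℝ≥0∞)) ∂Q = expNeg ((1 - expNeg c) * Λ A) := by
  by_cases hΛ : Λ A = ∞
  · rw [lintegral_congr_ae (g := fun _ => expNeg (c * ∞))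
      ((h.count_top A hA hΛ).mono fun ω hω => by simp [hω]), hΛ]
    -- for `c = 0` both sides are `1`, by the convention `0 * ∞ = 0`
    rcases eq_or_ne c 0 with rfl | hc
    · simp
    · have : 1 - expNeg c ≠ 0 := (tsub_pos_of_lt (expNeg_lt_one hc)).ne'
      simp [ENNReal.mul_top hc, ENNReal.mul_top this]
  · have hm := measurable_pointCount h.measurable hA
    have hg : Measurable fun n : ℕ∞ => expNeg (c * (n : ℝ≥0∞)) := by fun_prop
    rw [← lintegral_map (f := fun n : ℕ∞ => expNeg (c * (n : ℝ≥0∞))) hg hm,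
      h.count_law A hA hΛ, lintegral_map hg (by fun_prop)]
    simp only [ENat.toENNReal_coe]
    rw [lintegral_expNeg_poissonMeasure, ENNReal.coe_toNNReal hΛ]

/-- For a simple function `f` the sum over the points is a linear combination of the independent
counts of the level sets of `f`. -/
lemma IsPoissonPointProcess.laplace_simpleFunc {Q : Measure Ω} [IsProbabilityMeasure Q]
    {ξ : ℕ → Ω → E} {Λ : Measure E} (h : IsPoissonPointProcess Q ξ Λ)
    (f : SimpleFunc E ℝ≥0∞) :
    ∫⁻ ω, expNeg (∑' i, f (ξ i ω)) ∂Q = expNeg (∫⁻ x, (1 - expNeg (f x)) ∂Λ) := by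
  have hf : ∀ x, f x = ∑ c ∈ f.range, c * (f ⁻¹' {c}).indicator 1 x := fun x => by
    rw [Finset.sum_eq_single (f x)]
    · simp
    · intro b _ hb
      simp [Set.indicator, hb.symm]
    · intro hx
      exact absurd (f.mem_range_self x) hx
  have h1 : ∀ ω, ∑' i, f (ξ i ω)
      = ∑ c ∈ f.range, c * (pointCount ξ (f ⁻¹' {c}) ω : ℝ≥0∞) := fun ω => by
    simp_rw [coe_pointCount, ← ENNReal.tsum_mul_left]
    rw [← Summable.tsum_finsetSum fun _ _ => ENNReal.summable]
    exact tsum_congr fun i => hf _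
  have h2 : ∫⁻ x, (1 - expNeg (f x)) ∂Λ
      = ∑ c ∈ f.range, (1 - expNeg c) * Λ (f ⁻¹' {c}) := by
    have := SimpleFunc.lintegral_eq_lintegral (f.map fun c => 1 - expNeg c) Λ
    rw [SimpleFunc.map_lintegral] at this
    exact this
  let e := f.range.equivFin
  have hind : iIndepFun (fun (c : f.range) => pointCount ξ (f ⁻¹' {c.1})) Q := by
    have := h.count_indep f.range.card (fun j => f ⁻¹' {(e.symm j).1})
      (fun j => f.measurableSet_fiber _) (fun i j hij => by
        refine Disjoint.preimage _ ?_
        rw [Set.disjoint_singleton]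
        exact fun hc => hij (e.symm.injective (Subtype.ext hc)))
    have := this.precomp e.injective
    simpa using this
  have hind' : iIndepFun (fun (c : f.range) ω =>
      expNeg (c.1 * (pointCount ξ (f ⁻¹' {c.1}) ω : ℝ≥0∞))) Q :=
    hind.comp (fun c n => expNeg (c.1 * (n : ℝ≥0∞))) (fun c => by fun_prop)
  have h3 := lintegral_prod_eq_prod_lintegral_of_indepFun Finset.univ _ hind' (fun c =>
    measurable_expNeg.comp ((measurable_toENNReal_pointCount h.measurable
      (f.measurableSet_fiber _)).const_mul _))
  simp_rw [h1, expNeg_sum, h2, expNeg_sum]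
  rw [← Finset.prod_coe_sort]
  simp_rw [← Finset.prod_coe_sort f.range]
  rw [h3]
  exact Finset.prod_congr rfl fun c _ =>
    h.lintegral_expNeg_pointCount (f.measurableSet_fiber _) _

/-- The Laplace functional of a Poisson point process. -/
theorem IsPoissonPointProcess.laplace {Q : Measure Ω} [IsProbabilityMeasure Q]
    {ξ : ℕ → Ω → E} {Λ : Measure E} (h : IsPoissonPointProcess Q ξ Λ)
    {f : E → ℝ≥0∞} (hf : Measurable f) :
    ∫⁻ ω, expNeg (∑' i, f (ξ i ω)) ∂Q = expNeg (∫⁻ x, (1 - expNeg (f x)) ∂Λ) := by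
  let φ : ℕ → SimpleFunc E ℝ≥0∞ := SimpleFunc.eapprox f
  have hmono : ∀ x, Monotone fun n => φ n x := fun x m n hmn => SimpleFunc.monotone_eapprox f hmn x
  have hsup : ∀ x, Tendsto (fun n => φ n x) atTop (𝓝 (f x)) := fun x => by
    rw [← SimpleFunc.iSup_eapprox_apply hf x]
    exact tendsto_atTop_iSup (hmono x)
  have hsum : ∀ ω, Tendsto (fun n => ∑' i, φ n (ξ i ω)) atTop (𝓝 (∑' i, f (ξ i ω))) := fun ω => by
    simp_rw [← lintegral_count]
    exact lintegral_tendsto_of_tendsto_of_monotone (fun n => (by fun_prop))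
      (ae_of_all _ fun i => hmono _) (ae_of_all _ fun i => hsup _)
  have hm : ∀ n, Measurable fun ω => ∑' i, φ n (ξ i ω) := fun n =>
    Measurable.tsum fun i => (φ n).measurable.comp (h.measurable i)
  have hL : Tendsto (fun n => ∫⁻ ω, expNeg (∑' i, φ n (ξ i ω)) ∂Q) atTop
      (𝓝 (∫⁻ ω, expNeg (∑' i, f (ξ i ω)) ∂Q)) := by
    refine tendsto_lintegral_of_dominated_convergence (fun _ => 1)
      (fun n => measurable_expNeg.comp (hm n)) (fun n => ae_of_all _ fun ω => expNeg_le_one _)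
      (by simp) (ae_of_all _ fun ω => ?_)
    exact (continuous_expNeg.tendsto _).comp (hsum ω)
  have hR : Tendsto (fun n => expNeg (∫⁻ x, (1 - expNeg (φ n x)) ∂Λ)) atTop
      (𝓝 (expNeg (∫⁻ x, (1 - expNeg (f x)) ∂Λ))) := by
    refine (continuous_expNeg.tendsto _).comp ?_
    refine lintegral_tendsto_of_tendsto_of_monotone
      (fun n => ((measurable_expNeg.comp (φ n).measurable).const_sub 1).aemeasurable)
      (ae_of_all _ fun x m n hmn => tsub_le_tsub_left (expNeg_antitone (hmono x hmn)) _)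
      (ae_of_all _ fun x => ?_)
    exact ENNReal.Tendsto.sub tendsto_const_nhds ((continuous_expNeg.tendsto _).comp (hsup x))
      (Or.inl ENNReal.one_ne_top)
  refine tendsto_nhds_unique hL ?_
  simp_rw [h.laplace_simpleFunc]
  exact hR

end Poisson

/-! ### Marked Poisson point processes -/

section Marked

variable {Ω E F : Type*} [MeasurableSpace Ω] [MeasurableSpace E] [MeasurableSpace F]

/-- The kernel which, given a sequence `c`, makes the first `n` coordinates independent,
the `i`-th one having the law `κ (c i)`. -/
noncomputable def piKernel (κ : Kernel E F) [IsMarkovKernel κ] (n : ℕ) :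
    Kernel (ℕ → E) (Fin n → F) where
  toFun c := Measure.pi fun i : Fin n => κ (c i)
  measurable' := by
    refine Measurable.measure_of_isPiSystem_of_isProbabilityMeasure generateFrom_pi.symm
      isPiSystem_pi ?_
    rintro _ ⟨A, hA, rfl⟩
    simp_rw [Measure.pi_pi]
    exact Finset.measurable_fun_prod _ fun i _ =>
      (κ.measurable_coe (hA i trivial)).comp (measurable_pi_apply _)

lemma piKernel_apply (κ : Kernel E F) [IsMarkovKernel κ] (n : ℕ) (c : ℕ → E) :
    piKernel κ n c = Measure.pi fun i : Fin n => κ (c i) := rfl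

instance (κ : Kernel E F) [IsMarkovKernel κ] (n : ℕ) : IsMarkovKernel (piKernel κ n) :=
  ⟨fun c => by rw [piKernel_apply]; infer_instance⟩

/-- The random elements `X i` are marks of the random elements `ξ i`: given the whole sequence `ξ`,
they are independent, and `X i` has the law `κ (ξ i)`. -/
structure IsMarking (Q : Measure Ω) (ξ : ℕ → Ω → E) (κ : Kernel E F) (X : ℕ → Ω → F) : Prop where
  measurable_points : ∀ i, Measurable (ξ i)
  measurable_marks : ∀ i, Measurable (X i)
  conditional_law : ∀ (n : ℕ) (B : Set (ℕ → E)) (A : ℕ → Set F),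
    MeasurableSet B → (∀ i, MeasurableSet (A i)) →
    Q ({ω | (fun i => ξ i ω) ∈ B} ∩ {ω | ∀ i < n, X i ω ∈ A i}) =
      ∫⁻ ω in {ω | (fun i => ξ i ω) ∈ B}, ∏ i ∈ Finset.range n, κ (ξ i ω) (A i) ∂Q

variable {Q : Measure Ω} [IsProbabilityMeasure Q] {ξ : ℕ → Ω → E} {κ : Kernel E F}
  [IsMarkovKernel κ] {X : ℕ → Ω → F}

/-- The joint law of all points and the first `n` marks. -/
lemma IsMarking.map_eq (h : IsMarking Q ξ κ X) (n : ℕ) :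
    Q.map (fun ω => ((fun i => ξ i ω), fun i : Fin n => X i ω)) =
      (Q.map fun ω i => ξ i ω) ⊗ₘ piKernel κ n := by
  have hξ : Measurable fun ω i => ξ i ω := measurable_pi_lambda _ h.measurable_points
  have hX : Measurable fun ω (i : Fin n) => X i ω :=
    measurable_pi_lambda _ fun i => h.measurable_marks i
  have : IsProbabilityMeasure (Q.map fun ω i => ξ i ω) :=
    Measure.isProbabilityMeasure_map hξ.aemeasurable
  have : IsProbabilityMeasure (Q.map (fun ω => ((fun i => ξ i ω), fun i : Fin n => X i ω))) :=
    Measure.isProbabilityMeasure_map (hξ.prodMk hX).aemeasurable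
  refine Measure.ext_prod fun {B C} hB hC => ?_
  set M₁ := Q.map (fun ω => ((fun i => ξ i ω), fun i : Fin n => X i ω))
  set M₂ := (Q.map fun ω i => ξ i ω) ⊗ₘ piKernel κ n
  have key : (M₁.restrict (B ×ˢ Set.univ)).map Prod.snd
      = (M₂.restrict (B ×ˢ Set.univ)).map Prod.snd := by
    have hbox : ∀ A : Fin n → Set F, (∀ i, MeasurableSet (A i)) →
        M₁ (B ×ˢ Set.univ.pi A) = M₂ (B ×ˢ Set.univ.pi A) := by
      intro A hA
      have hpi : MeasurableSet (Set.univ.pi A) := .univ_pi hA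
      let A' : ℕ → Set F := fun i => if hi : i < n then A ⟨i, hi⟩ else Set.univ
      have hA' : ∀ i : Fin n, A' i = A i := fun i => by simp [A']
      have hcl := h.conditional_law n B A' hB (fun i => by
        by_cases hi : i < n <;> simp [A', hi, hA])
      rw [Measure.map_apply (hξ.prodMk hX) (hB.prod hpi), Measure.compProd_apply_prod hB hpi,
        setLIntegral_map hB (Kernel.measurable_coe _ hpi) hξ]
      simp_rw [piKernel_apply, Measure.pi_pi]
      convert hcl using 2
      · ext ω
        simp only [Set.mem_preimage, Set.mem_prod, Set.mem_pi, Set.mem_univ, true_imp_iff,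
          Set.mem_inter_iff, Set.mem_ofPred_eq]
        refine and_congr Iff.rfl ⟨fun H i hi => ?_, fun H i => ?_⟩
        · simpa [A', hi] using H ⟨i, hi⟩
        · simpa [A'] using H i i.2
      · rfl
      · ext ω
        rw [← Fin.prod_univ_eq_prod_range (fun i => κ (ξ i ω) (A' i))]
        simp_rw [hA']
    refine ext_of_generate_finite _ generateFrom_pi.symm isPiSystem_pi ?_ ?_
    · rintro _ ⟨A, hA, rfl⟩
      have hA : ∀ i, MeasurableSet (A i) := fun i => hA i trivial
      have hpi : MeasurableSet (Set.univ.pi A) := .univ_pi hA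
      rw [Measure.map_apply measurable_snd hpi, Measure.map_apply measurable_snd hpi,
        Measure.restrict_apply (measurable_snd hpi), Measure.restrict_apply (measurable_snd hpi)]
      convert hbox A hA using 2 <;> · ext; simp [and_comm]
    · have := hbox (fun _ => Set.univ) fun _ => .univ
      rw [Set.pi_univ] at this
      simpa [Measure.map_apply measurable_snd] using this
  have := congrArg (fun M => M C) key
  simp only [Measure.map_apply measurable_snd hC,
    Measure.restrict_apply (measurable_snd hC)] at this
  convert this using 2 <;> · ext; simp [and_comm]

lemma IsMarking.measure_forall_lt (h : IsMarking Q ξ κ X) (n : ℕ) {D : Set (E × F)}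
    (hD : MeasurableSet D) :
    Q {ω | ∀ i < n, (ξ i ω, X i ω) ∈ D} =
      ∫⁻ ω, ∏ i ∈ Finset.range n, κ (ξ i ω) {f | (ξ i ω, f) ∈ D} ∂Q := by
  have hξ : Measurable fun ω i => ξ i ω := measurable_pi_lambda _ h.measurable_points
  have hX : Measurable fun ω (i : Fin n) => X i ω :=
    measurable_pi_lambda _ fun i => h.measurable_marks i
  let S : Set ((ℕ → E) × (Fin n → F)) := {q | ∀ i : Fin n, (q.1 i, q.2 i) ∈ D}
  have hS : MeasurableSet S := by
    have : S = ⋂ i : Fin n, (fun q : (ℕ → E) × (Fin n → F) => (q.1 i, q.2 i)) ⁻¹' D := by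
      ext; simp [S]
    rw [this]
    refine .iInter fun i => hD.preimage (by fun_prop)
  have h1 : {ω | ∀ i < n, (ξ i ω, X i ω) ∈ D}
      = (fun ω => ((fun i => ξ i ω), fun i : Fin n => X i ω)) ⁻¹' S := by
    ext ω
    exact ⟨fun H i => H i i.2, fun H i hi => H ⟨i, hi⟩⟩
  have : IsProbabilityMeasure (Q.map fun ω i => ξ i ω) :=
    Measure.isProbabilityMeasure_map hξ.aemeasurable
  rw [h1, ← Measure.map_apply (hξ.prodMk hX) hS, h.map_eq, Measure.compProd_apply hS,
    lintegral_map (Kernel.measurable_kernel_prodMk_left hS) hξ]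
  congr with ω
  rw [piKernel_apply, ← Fin.prod_univ_eq_prod_range (fun i => κ (ξ i ω) {f | (ξ i ω, f) ∈ D}),
    ← Measure.pi_pi]
  congr 1
  ext g
  simp [S]

/-- The marking theorem for Poisson point processes, in the form of void probabilities: no point
with its mark lies outside `D` with probability `e^{-(Λ ⊗ κ)(Dᶜ)}`. -/
theorem IsMarking.measure_forall (h : IsMarking Q ξ κ X) {Λ : Measure E}
    (hP : IsPoissonPointProcess Q ξ Λ) {D : Set (E × F)} (hD : MeasurableSet D) :
    Q {ω | ∀ i, (ξ i ω, X i ω) ∈ D} = expNeg (∫⁻ e, κ e {f | (e, f) ∉ D} ∂Λ) := by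
  have hk : Measurable fun e => κ e {f | (e, f) ∈ D} := Kernel.measurable_kernel_prodMk_left hD
  -- the cumulant function `f` with `e^{-f} = κ(·, D)`
  let f : E → ℝ≥0∞ := fun e => (-ENNReal.log (κ e {f | (e, f) ∈ D})).toENNReal
  have hf : Measurable f := hk.ennreal_log.neg.ereal_toENNReal
  have hfe : ∀ e, expNeg (f e) = κ e {f | (e, f) ∈ D} := fun e => exists_expNeg_eq prob_le_one
  have h1 : ∀ e, 1 - expNeg (f e) = κ e {f | (e, f) ∉ D} := fun e => by
    rw [hfe]
    exact (prob_compl_eq_one_sub (measurable_prodMk_left hD)).symm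
  have hDm : ∀ i, MeasurableSet {ω | (ξ i ω, X i ω) ∈ D} := fun i =>
    ((h.measurable_points i).prodMk (h.measurable_marks i)) hD
  have hset : {ω | ∀ i, (ξ i ω, X i ω) ∈ D} = ⋂ n, {ω | ∀ i < n, (ξ i ω, X i ω) ∈ D} := by
    ext ω
    simp only [Set.mem_ofPred_eq, Set.mem_iInter]
    exact ⟨fun H n i _ => H i, fun H i => H (i + 1) i (Nat.lt_succ_self i)⟩
  have hL : Tendsto (fun n => Q {ω | ∀ i < n, (ξ i ω, X i ω) ∈ D}) atTop
      (𝓝 (Q {ω | ∀ i, (ξ i ω, X i ω) ∈ D})) := by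
    rw [hset]
    refine tendsto_measure_iInter_atTop (fun n => ?_)
      (fun m n hmn ω H i hi => H i (hi.trans_le hmn)) ⟨0, measure_ne_top _ _⟩
    have : {ω | ∀ i < n, (ξ i ω, X i ω) ∈ D} = ⋂ i, ⋂ (_ : i < n), {ω | (ξ i ω, X i ω) ∈ D} := by
      ext; simp
    rw [this]
    exact (MeasurableSet.iInter fun i => .iInter fun _ => hDm i).nullMeasurableSet
  have hR : Tendsto (fun n => ∫⁻ ω, expNeg (∑ i ∈ Finset.range n, f (ξ i ω)) ∂Q) atTop
      (𝓝 (∫⁻ ω, expNeg (∑' i, f (ξ i ω)) ∂Q)) := by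
    refine tendsto_lintegral_of_dominated_convergence (fun _ => 1)
      (fun n => measurable_expNeg.comp (Finset.measurable_fun_sum _ fun i _ =>
        hf.comp (h.measurable_points i)))
      (fun n => ae_of_all _ fun ω => expNeg_le_one _) (by simp) (ae_of_all _ fun ω => ?_)
    exact (continuous_expNeg.tendsto _).comp ENNReal.summable.hasSum.tendsto_sum_nat
  rw [hP.laplace hf] at hR
  simp_rw [h1] at hR
  refine tendsto_nhds_unique hL (hR.congr fun n => ?_)
  simp_rw [h.measure_forall_lt n hD, expNeg_sum, hfe]

end Marked

/-! ### The exponent measure of a max-stable process -/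

section Gumbel

instance : SFinite gumbelIntensity := by unfold gumbelIntensity; infer_instance

lemma gumbelIntensity_Ioi (a : ℝ) :
    gumbelIntensity (Set.Ioi a) = ENNReal.ofReal (Real.exp (-a)) := by
  rw [gumbelIntensity, withDensity_apply _ measurableSet_Ioi, ← integral_exp_neg_Ioi,
    ofReal_integral_eq_lintegral_ofReal (integrableOn_exp_neg_Ioi a)
      (ae_of_all _ fun x => (Real.exp_pos _).le)]

lemma gumbelIntensity_lt_add {z : EReal} (hz : z ≠ ⊤) (x : ℝ) :
    gumbelIntensity {p : ℝ | (x : EReal) < p + z} =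
      ENNReal.ofReal (Real.exp (-x)) * EReal.exp z := by
  induction z with
  | bot => simp
  | top => exact absurd rfl hz
  | coe z =>
    have : {p : ℝ | (x : EReal) < p + z} = Set.Ioi (x - z) := by
      ext p
      rw [Set.mem_ofPred_eq, ← EReal.coe_add, EReal.coe_lt_coe_iff, Set.mem_Ioi, sub_lt_iff_lt_add]
    rw [this, gumbelIntensity_Ioi, EReal.exp_coe, ← ENNReal.ofReal_mul (Real.exp_pos _).le,
      ← Real.exp_add]
    congr 2
    ring

/-- A translation multiplies `e^{-p} dp` by a constant. -/
lemma gumbelIntensity_preimage_sub {A : Set ℝ} (hA : MeasurableSet A) (c : ℝ) :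
    gumbelIntensity {p : ℝ | p - c ∈ A} = ENNReal.ofReal (Real.exp (-c)) * gumbelIntensity A := by
  have hA' : MeasurableSet {p : ℝ | p - c ∈ A} := (measurable_id.sub_const c) hA
  rw [gumbelIntensity, withDensity_apply _ hA', withDensity_apply _ hA,
    ← lintegral_indicator hA', ← lintegral_indicator hA, ← lintegral_const_mul _
      ((by fun_prop : Measurable fun p : ℝ => ENNReal.ofReal (Real.exp (-p))).indicator hA)]
  refine Eq.trans ?_ (lintegral_sub_right_eq_self (fun p => ENNReal.ofReal (Real.exp (-c)) *
    A.indicator (fun p => ENNReal.ofReal (Real.exp (-p))) p) c)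
  refine lintegral_congr fun p => ?_
  by_cases hp : p - c ∈ A
  · rw [Set.indicator_of_mem (by exact hp), Set.indicator_of_mem hp,
      ← ENNReal.ofReal_mul (Real.exp_pos _).le, ← Real.exp_add]
    congr 2
    ring
  · rw [Set.indicator_of_notMem (by exact hp), Set.indicator_of_notMem hp, mul_zero]

end Gumbel

section DistributionFunction

/-- A probability law on `[-∞, ∞]^ι` without mass at `+∞` is determined by its distribution function
at real arguments. -/
lemma ext_of_real_boxes {ι : Type*} [Fintype ι] {μ ν : Measure (ι → EReal)}
    [IsProbabilityMeasure μ] [IsProbabilityMeasure ν] (hν : ∀ᵐ v ∂ν, ∀ k, v k ≠ ⊤)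
    (h : ∀ x : ι → ℝ, μ {v | ∀ k, v k ≤ (x k : EReal)} = ν {v | ∀ k, v k ≤ (x k : EReal)}) :
    μ = ν := by
  have hbox : ∀ x : ι → EReal, MeasurableSet {v : ι → EReal | ∀ k, v k ≤ x k} := fun x => by
    have : {v : ι → EReal | ∀ k, v k ≤ x k} = Set.Iic x := rfl
    rw [this, ← Set.pi_univ_Iic]
    exact .univ_pi fun _ => measurableSet_Iic
  have hμ : ∀ᵐ v ∂μ, ∀ k, v k ≠ ⊤ := by
    have hU : {v : ι → EReal | ∀ k, v k ≠ ⊤}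
        = ⋃ n : ℕ, {v : ι → EReal | ∀ k, v k ≤ ((n : ℝ) : EReal)} := by
      ext v
      simp only [Set.mem_ofPred_eq, Set.mem_iUnion]
      refine ⟨fun H => ?_, fun ⟨n, hn⟩ k hk => (EReal.coe_lt_top _).not_ge (hk ▸ hn k)⟩
      choose N hN using fun k => (EReal.lt_iff_exists_real_btwn.1 (lt_top_iff_ne_top.2 (H k)))
      obtain ⟨n, hn⟩ := exists_nat_ge (∑ k, |N k|)
      refine ⟨n, fun k => (hN k).1.le.trans (EReal.coe_le_coe_iff.2 ?_)⟩
      exact (le_abs_self _).trans ((Finset.single_le_sum (f := fun k => |N k|)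
        (fun _ _ => abs_nonneg _) (Finset.mem_univ k)).trans hn)
    have hm : Monotone fun n : ℕ => {v : ι → EReal | ∀ k, v k ≤ ((n : ℝ) : EReal)} :=
      fun m n hmn v hv k => (hv k).trans (EReal.coe_le_coe_iff.2 (by exact_mod_cast hmn))
    have hmeas : MeasurableSet {v : ι → EReal | ∀ k, v k ≠ ⊤} := by
      rw [hU]; exact .iUnion fun n => hbox _
    have h1 : μ {v : ι → EReal | ∀ k, v k ≠ ⊤} = ν {v : ι → EReal | ∀ k, v k ≠ ⊤} := by
      rw [hU, hm.measure_iUnion, hm.measure_iUnion]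
      simp_rw [h (fun _ => _)]
    exact (prob_compl_eq_zero_iff hmeas).2 (h1.trans ((prob_compl_eq_zero_iff hmeas).1 hν))
  have hall : ∀ x : ι → EReal, μ {v | ∀ k, v k ≤ x k} = ν {v | ∀ k, v k ≤ x k} := by
    intro x
    -- real corners whose boxes converge to the box of `x` away from `+∞`
    let y : ℕ → ι → ℝ := fun n k => if x k = ⊥ then -n else if x k = ⊤ then n else (x k).toReal
    have hy : ∀ v : ι → EReal, (∀ k, v k ≠ ⊤) →
        ∀ᶠ n in atTop, (∀ k, v k ≤ y n k) ↔ (∀ k, v k ≤ x k) := by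
      intro v hv
      have : ∀ k, ∀ᶠ n in atTop, v k ≤ y n k ↔ v k ≤ x k := by
        intro k
        rcases eq_or_ne (x k) ⊥ with hb | hb
        · simp only [y, hb, if_true, le_bot_iff]
          rcases eq_or_ne (v k) ⊥ with hvb | hvb
          · simp [hvb]
          · obtain ⟨r, hr⟩ := EReal.lt_iff_exists_real_btwn.1 (bot_lt_iff_ne_bot.2 hvb)
            filter_upwards [tendsto_natCast_atTop_atTop.eventually_gt_atTop (-r)] with n hn
            simp only [hvb, iff_false, not_le]
            exact lt_trans (EReal.coe_lt_coe_iff.2 (by linarith)) hr.2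
        · rcases eq_or_ne (x k) ⊤ with ht | ht
          · obtain ⟨r, hr⟩ := EReal.lt_iff_exists_real_btwn.1 (lt_top_iff_ne_top.2 (hv k))
            filter_upwards [tendsto_natCast_atTop_atTop.eventually_gt_atTop r] with n hn
            simp only [y, ht, le_top, iff_true]
            exact hr.1.le.trans (EReal.coe_le_coe_iff.2 hn.le)
          · exact Eventually.of_forall fun n => by
              simp only [y, hb, ht, if_false, EReal.coe_toReal ht hb]
      filter_upwards [eventually_all.2 this] with n hn
      exact forall_congr' hn
    have lim : ∀ (M : Measure (ι → EReal)) [IsProbabilityMeasure M], (∀ᵐ v ∂M, ∀ k, v k ≠ ⊤) →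
        Tendsto (fun n => M {v | ∀ k, v k ≤ (y n k : EReal)}) atTop
          (𝓝 (M {v | ∀ k, v k ≤ x k})) := fun M _ hM =>
      tendsto_measure_of_ae_tendsto_indicator_of_isFiniteMeasure atTop (hbox x)
        (fun n => hbox _) (hM.mono fun v hv => hy v hv)
    refine tendsto_nhds_unique (lim μ hμ) ?_
    simp_rw [h]
    exact lim ν hν
  have hgen : (MeasurableSpace.pi : MeasurableSpace (ι → EReal)) = MeasurableSpace.generateFrom
      (Set.univ.pi '' Set.univ.pi fun _ : ι => Set.range (Set.Iic : EReal → Set EReal)) := by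
    refine (generateFrom_eq_pi (fun _ => ?_) fun _ => ?_).symm
    · rw [← borel_eq_generateFrom_Iic]
      exact (BorelSpace.measurable_eq (α := EReal)).symm
    · exact ⟨fun _ => Set.Iic ⊤, fun _ => ⟨⊤, rfl⟩, by simp [Set.iUnion_const]⟩
  refine ext_of_generate_finite _ hgen (IsPiSystem.pi fun _ => ?_) ?_ (by simp)
  · rintro _ ⟨a, rfl⟩ _ ⟨b, rfl⟩ -
    exact ⟨a ⊓ b, Set.Iic_inter_Iic.symm⟩
  · rintro _ ⟨A, hA, rfl⟩
    choose x hx using fun k => hA k trivial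
    convert hall x using 2 <;> · ext v; simp [← hx]

end DistributionFunction

lemma measurableSet_box {ι : Type*} [Countable ι] (x : ι → ℝ) :
    MeasurableSet {v : ι → EReal | ∀ k, v k ≤ (x k : EReal)} := by
  simp_rw [Set.ofPred_forall]
  exact .iInter fun k => measurableSet_le (measurable_pi_apply k) measurable_const

section ExponentMeasure

variable {Ω Ω' T ι : Type*} [MeasurableSpace Ω] [MeasurableSpace Ω']

/-- The exponent measure of the vector `(ζ(t k))_k`: the image of `e^{-p} dp ⊗ P` under
`(p, ω) ↦ (p + Z(t k))_k`, i.e. the intensity of the points `(P_i + Z_i(t k))_k`. -/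
noncomputable def exponentMeasure (P : Measure Ω) (Z : Ω → T → EReal) (t : ι → T) :
    Measure (ι → EReal) :=
  (gumbelIntensity.prod P).map fun q k => (q.1 : EReal) + Z q.2 (t k)

variable {P : Measure Ω} {Z : Ω → T → EReal}

lemma IsSpectralProcess.measurable_eval (hZ : IsSpectralProcess P Z) (t : T) :
    Measurable fun ω => Z ω t :=
  (measurable_pi_apply t).comp hZ.measurable

lemma IsSpectralProcess.measurable_shift (hZ : IsSpectralProcess P Z) (t : ι → T) :
    Measurable fun (q : ℝ × Ω) k => (q.1 : EReal) + Z q.2 (t k) :=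
  measurable_pi_lambda _ fun k => (measurable_coe_real_ereal.comp measurable_fst).add
    ((hZ.measurable_eval (t k)).comp measurable_snd)

lemma IsSpectralProcess.exponentMeasure_apply [SFinite P] (hZ : IsSpectralProcess P Z) (t : ι → T)
    {A : Set (ι → EReal)} (hA : MeasurableSet A) :
    exponentMeasure P Z t A =
      ∫⁻ ω, gumbelIntensity {p : ℝ | (fun k => (p : EReal) + Z ω (t k)) ∈ A} ∂P := by
  rw [exponentMeasure, Measure.map_apply (hZ.measurable_shift t) hA,
    Measure.prod_apply_symm ((hZ.measurable_shift t) hA)]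
  rfl

lemma IsSpectralProcess.exponentMeasure_lt [SFinite P] (hZ : IsSpectralProcess P Z) (t : ι → T)
    (k : ι) (x : ℝ) :
    exponentMeasure P Z t {v | (x : EReal) < v k} = ENNReal.ofReal (Real.exp (-x)) := by
  rw [hZ.exponentMeasure_apply t (measurableSet_lt measurable_const (measurable_pi_apply k))]
  simp_rw [Set.mem_ofPred_eq, gumbelIntensity_lt_add (hZ.ne_top _ _)]
  rw [lintegral_const_mul _ (hZ.measurable_eval _).ereal_exp, hZ.lintegral_exp, mul_one]

lemma IsSpectralProcess.exponentMeasure_compl_box_ne_top [SFinite P] [Fintype ι]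
    (hZ : IsSpectralProcess P Z) (t : ι → T) (x : ι → ℝ) :
    exponentMeasure P Z t {v | ¬ ∀ k, v k ≤ (x k : EReal)} ≠ ∞ := by
  have : {v : ι → EReal | ¬ ∀ k, v k ≤ (x k : EReal)} = ⋃ k, {v | (x k : EReal) < v k} := by
    ext; simp
  rw [this]
  refine ((measure_iUnion_fintype_le _ _).trans_lt (ENNReal.sum_lt_top.2 fun k _ => ?_)).ne
  rw [hZ.exponentMeasure_lt]
  exact ENNReal.ofReal_lt_top

variable {Q : Measure Ω'} {p : ℕ → Ω' → ℝ} {Zs : ℕ → Ω' → T → EReal}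

lemma IsSpectralSystem.isMarking (h : IsSpectralSystem P Z Q p Zs) :
    IsMarking Q p (Kernel.const ℝ (P.map Z)) Zs where
  measurable_points := h.poisson.measurable
  measurable_marks := h.measurable_copies
  conditional_law n B A hB hA := by
    have h1 : {ω | ∀ i < n, Zs i ω ∈ A i} = ⋂ i ∈ Finset.range n, Zs i ⁻¹' A i := by
      ext; simp
    have h2 := h.indep_points.measure_inter_preimage_eq_mul B {g | ∀ i < n, g i ∈ A i} hB (by
      simp_rw [Set.ofPred_forall]
      exact .iInter fun i => .iInter fun _ => (measurable_pi_apply i) (hA i))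
    refine h2.trans ?_
    simp only [Kernel.const_apply, setLIntegral_const]
    rw [mul_comm]
    congr 1
    refine (congrArg Q h1).trans ?_
    rw [h.indep_copies.measure_inter_preimage_eq_mul _ (fun i _ => hA i)]
    refine Finset.prod_congr rfl fun i _ => ?_
    rw [← (h.copies i).map_eq, Measure.map_apply (h.measurable_copies i) (hA i)]

lemma IsSpectralSystem.measurable_maxProcess_apply (h : IsSpectralSystem P Z Q p Zs) (t : T) :
    Measurable fun ω => maxProcess p Zs ω t :=
  .iSup fun i => (measurable_coe_real_ereal.comp (h.poisson.measurable i)).add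
    ((measurable_pi_apply t).comp (h.measurable_copies i))

variable [IsProbabilityMeasure P] [IsProbabilityMeasure Q]

/-- The finite-dimensional distribution functions of `ζ`: `H(x) = e^{-V(x)}`, where `V(x)` is the
mass that the exponent measure gives to the complement of the box with upper corner `x`. -/
lemma IsSpectralSystem.measure_le [Countable ι] (hZ : IsSpectralProcess P Z)
    (h : IsSpectralSystem P Z Q p Zs) (t : ι → T) (x : ι → ℝ) :
    Q {ω | ∀ k, maxProcess p Zs ω (t k) ≤ (x k : EReal)} =
      expNeg (exponentMeasure P Z t {v | ¬ ∀ k, v k ≤ (x k : EReal)}) := by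
  have : IsProbabilityMeasure (P.map Z) :=
    Measure.isProbabilityMeasure_map hZ.measurable.aemeasurable
  let D : Set (ℝ × (T → EReal)) := {q | ∀ k, (q.1 : EReal) + q.2 (t k) ≤ (x k : EReal)}
  have hD : MeasurableSet D := by
    have : Measurable fun (q : ℝ × (T → EReal)) k => (q.1 : EReal) + q.2 (t k) :=
      measurable_pi_lambda _ fun k => (measurable_coe_real_ereal.comp measurable_fst).add
        ((measurable_pi_apply (t k)).comp measurable_snd)
    exact this (measurableSet_box x)
  have hset : {ω | ∀ k, maxProcess p Zs ω (t k) ≤ (x k : EReal)}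
      = {ω | ∀ i, (p i ω, Zs i ω) ∈ D} := by
    ext ω
    simp only [maxProcess, iSup_le_iff, Set.mem_ofPred_eq, D]
    exact forall_comm
  have hbox : MeasurableSet {v : ι → EReal | ¬ ∀ k, v k ≤ (x k : EReal)} :=
    (measurableSet_box x).compl
  rw [hset, h.isMarking.measure_forall h.poisson hD, exponentMeasure,
    Measure.map_apply (hZ.measurable_shift t) hbox,
    Measure.prod_apply ((hZ.measurable_shift t) hbox)]
  congr 1
  refine lintegral_congr fun r => ?_
  rw [Kernel.const_apply, Measure.map_apply hZ.measurable]
  · rfl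
  · exact (measurable_prodMk_left hD).compl

lemma IsSpectralSystem.jointDF_eq [Fintype ι] (hZ : IsSpectralProcess P Z)
    (h : IsSpectralSystem P Z Q p Zs) (t : ι → T) (x : ι → ℝ) :
    jointDF Q (maxProcess p Zs) t x =
      Real.exp (-(exponentMeasure P Z t).real {v | ¬ ∀ k, v k ≤ (x k : EReal)}) := by
  rw [jointDF, measureReal_def, h.measure_le hZ,
    expNeg_eq_ofReal (hZ.exponentMeasure_compl_box_ne_top t x),
    ENNReal.toReal_ofReal (Real.exp_pos _).le, measureReal_def]

lemma IsSpectralSystem.ae_maxProcess_ne_top (hZ : IsSpectralProcess P Z)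
    (h : IsSpectralSystem P Z Q p Zs) (t : T) : ∀ᵐ ω ∂Q, maxProcess p Zs ω t ≠ ⊤ := by
  have hm : MeasurableSet {ω | maxProcess p Zs ω t ≠ ⊤} :=
    (measurableSet_eq_fun (h.measurable_maxProcess_apply t) measurable_const).compl
  have hle : ∀ n : ℕ, expNeg (ENNReal.ofReal (Real.exp (-n)))
      ≤ Q {ω | maxProcess p Zs ω t ≠ ⊤} := fun n => by
    have := h.measure_le hZ (fun _ : Unit => t) (fun _ => (n : ℝ))
    have hset : {v : Unit → EReal | ¬ ∀ k, v k ≤ ((n : ℝ) : EReal)}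
        = {v | ((n : ℝ) : EReal) < v ()} := by
      ext v
      simp only [Set.mem_ofPred_eq, not_forall, not_le]
      exact ⟨fun ⟨_, h⟩ => h, fun h => ⟨(), h⟩⟩
    rw [hset, hZ.exponentMeasure_lt] at this
    rw [← this]
    exact measure_mono fun ω hω hω' => (EReal.coe_lt_top _).not_ge (hω' ▸ hω ())
  have hlim : Tendsto (fun n : ℕ => expNeg (ENNReal.ofReal (Real.exp (-n)))) atTop (𝓝 1) := by
    rw [← expNeg_zero, ← ENNReal.ofReal_zero]
    exact (continuous_expNeg.tendsto _).comp ((ENNReal.continuous_ofReal.tendsto _).comp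
      (Real.tendsto_exp_neg_atTop_nhds_zero.comp tendsto_natCast_atTop_atTop))
  have := le_of_tendsto' hlim hle
  exact (prob_compl_eq_zero_iff hm).2 (le_antisymm prob_le_one this)

end ExponentMeasure

/-! ### Tilted spectral processes and generalised Pareto vectors -/

lemma measurable_ereal_sub {α : Type*} [MeasurableSpace α] {f g : α → EReal} (hf : Measurable f)
    (hg : Measurable g) : Measurable fun a => f a - g a := by
  simp_rw [sub_eq_add_neg]
  exact hf.add hg.neg

lemma measurable_increments {T ι : Type*} (t : ι → T) (h : T) :
    Measurable fun (f : T → EReal) k => f (t k) - f h :=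
  measurable_pi_lambda _ fun _ => measurable_ereal_sub (measurable_pi_apply _)
    (measurable_pi_apply _)

lemma ereal_coe_add_sub_coe_add (p z : ℝ) (a : EReal) :
    ((p : EReal) + a) - ((p : EReal) + z) = a - z := by
  induction a with
  | bot => simp
  | top => rw [EReal.coe_add_top, ← EReal.coe_add, EReal.top_sub_coe, EReal.top_sub_coe]
  | coe a =>
    rw [← EReal.coe_add, ← EReal.coe_add, ← EReal.coe_sub, ← EReal.coe_sub]
    congr 1
    ring

section Tilt

variable {Ω T ι : Type*} [MeasurableSpace Ω] {P : Measure Ω} {Z : Ω → T → EReal}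

lemma IsSpectralProcess.measurable_sub (hZ : IsSpectralProcess P Z) (h : T) :
    Measurable fun ω t => Z ω t - Z ω h :=
  (measurable_increments id h).comp hZ.measurable

lemma IsSpectralProcess.tiltedSpectralLaw_eq (hZ : IsSpectralProcess P Z) (h : T) :
    tiltedSpectralLaw P Z h =
      (P.withDensity fun ω => EReal.exp (Z ω h)).map fun ω t => Z ω t - Z ω h := by
  rw [tiltedSpectralLaw, tiltLaw, Measure.map_map _ hZ.measurable]
  · rfl
  · exact measurable_increments id h

lemma IsSpectralProcess.tiltedSpectralLaw_apply (hZ : IsSpectralProcess P Z) (h : T)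
    {A : Set (T → EReal)} (hA : MeasurableSet A) :
    tiltedSpectralLaw P Z h A =
      ∫⁻ ω, {ω | (fun t => Z ω t - Z ω h) ∈ A}.indicator (fun ω => EReal.exp (Z ω h)) ω ∂P := by
  have hm : MeasurableSet {ω | (fun t => Z ω t - Z ω h) ∈ A} := hZ.measurable_sub h hA
  rw [hZ.tiltedSpectralLaw_eq, Measure.map_apply (hZ.measurable_sub h) hA,
    withDensity_apply _ (hZ.measurable_sub h hA), lintegral_indicator hm]
  rfl

lemma IsSpectralProcess.isProbabilityMeasure_tiltedSpectralLaw (hZ : IsSpectralProcess P Z)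
    (h : T) : IsProbabilityMeasure (tiltedSpectralLaw P Z h) :=
  ⟨by
    rw [hZ.tiltedSpectralLaw_apply h .univ, ← hZ.lintegral_exp h]
    simp⟩

/-- Under the exponent measure restricted to `v i₀ > 0`, the increments `v k - v i₀` have the law of
`Ξ_h Z (t k)`, where `h = t i₀`: integrating `e^{-p}` over `p > -Z(h)` gives the density
`e^{Z(h)}` of the tilt. -/
lemma IsSpectralProcess.exponentMeasure_inter_increments [SFinite P] [Countable ι]
    (hZ : IsSpectralProcess P Z) (t : ι → T) (i₀ : ι) {A : Set (ι → EReal)}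
    (hA : MeasurableSet A) :
    exponentMeasure P Z t ({v | 0 < v i₀} ∩ {v | (fun k => v k - v i₀) ∈ A}) =
      (tiltedSpectralLaw P Z (t i₀)).map (fun f k => f (t k)) A := by
  have hB : MeasurableSet ({v : ι → EReal | 0 < v i₀} ∩ {v | (fun k => v k - v i₀) ∈ A}) :=
    (measurableSet_lt measurable_const (measurable_pi_apply i₀)).inter
      (measurable_increments id i₀ hA)
  have hp : Measurable fun (f : T → EReal) (k : ι) => f (t k) :=
    measurable_pi_lambda _ fun k => measurable_pi_apply _
  rw [hZ.exponentMeasure_apply t hB, Measure.map_apply hp hA,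
    hZ.tiltedSpectralLaw_apply _ (hp hA)]
  refine lintegral_congr fun ω => ?_
  have h0 := hZ.ne_top ω (t i₀)
  have hgum := gumbelIntensity_lt_add h0 0
  -- if `Z(t i₀) = -∞`, then no `p` contributes and the density `e^{Z(t i₀)}` vanishes
  by_cases hbot : Z ω (t i₀) = ⊥
  · simp [hbot, Set.indicator]
  · obtain ⟨z, hz⟩ : ∃ z : ℝ, Z ω (t i₀) = z := ⟨_, (EReal.coe_toReal h0 hbot).symm⟩
    simp only [Set.mem_inter_iff, Set.mem_ofPred_eq]
    simp_rw [hz, ereal_coe_add_sub_coe_add]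
    rw [hz] at hgum
    by_cases hmem : (fun k => Z ω (t k) - (z : EReal)) ∈ A
    · rw [Set.indicator_of_mem (by simpa [hz] using hmem)]
      simpa [hmem, hz] using hgum
    · rw [Set.indicator_of_notMem (by simpa [hz] using hmem)]
      simp [hmem]

lemma IsSpectralProcess.lintegral_tiltedSpectralLaw [SFinite P] (hZ : IsSpectralProcess P Z)
    (h : T) {M : Set (ℝ × (T → EReal))} (hM : MeasurableSet M) :
    ∫⁻ p, tiltedSpectralLaw P Z h {f | (p, f) ∈ M} ∂gumbelIntensity =
      ∫⁻ ω, EReal.exp (Z ω h) * gumbelIntensity {p | (p, fun t => Z ω t - Z ω h) ∈ M} ∂P := by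
  have := hZ.isProbabilityMeasure_tiltedSpectralLaw h
  have hg : Measurable fun f : T → EReal => gumbelIntensity {p | (p, f) ∈ M} :=
    measurable_measure_prodMk_right hM
  calc ∫⁻ p, tiltedSpectralLaw P Z h {f | (p, f) ∈ M} ∂gumbelIntensity
      = ∫⁻ f, gumbelIntensity {p | (p, f) ∈ M} ∂tiltedSpectralLaw P Z h :=
        (Measure.prod_apply hM).symm.trans (Measure.prod_apply_symm hM)
    _ = _ := by
      rw [hZ.tiltedSpectralLaw_eq, lintegral_map hg (hZ.measurable_sub h),
        lintegral_withDensity_eq_lintegral_mul _ (hZ.measurable_eval h).ereal_exp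
          (by exact hg.comp (hZ.measurable_sub h))]
      rfl

end Tilt

section Pareto

variable {Ω Ω' T ι : Type*} [MeasurableSpace Ω] [MeasurableSpace Ω']
  {P : Measure Ω} {Z : Ω → T → EReal}
  {Q : Measure Ω'} [IsProbabilityMeasure Q] {p : ℕ → Ω' → ℝ} {Zs : ℕ → Ω' → T → EReal}

/-- The generalised Pareto law: the exponent measure conditioned on a positive component. -/
noncomputable def paretoMeasure (P : Measure Ω) (Z : Ω → T → EReal) (t : ι → T) :
    Measure (ι → EReal) :=
  cond (exponentMeasure P Z t) {v | ¬ ∀ k, v k ≤ ((0 : ι → ℝ) k : EReal)}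

lemma setOf_pos_subset (i₀ : ι) :
    {v : ι → EReal | 0 < v i₀} ⊆ {v | ¬ ∀ k, v k ≤ ((0 : ι → ℝ) k : EReal)} :=
  fun v hv hv' => (hv' i₀).not_gt (by simpa using hv)

lemma IsSpectralProcess.ae_paretoMeasure_ne_top [Countable ι] (hZ : IsSpectralProcess P Z)
    (t : ι → T) :
    ∀ᵐ v ∂paretoMeasure P Z t, ∀ k, v k ≠ ⊤ := by
  refine cond_absolutelyContinuous.ae_le ?_
  refine ae_all_iff.2 fun k => ?_
  have hm : MeasurableSet {v : ι → EReal | v k ≠ ⊤} :=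
    (measurable_pi_apply k) (measurableSet_singleton ⊤).compl
  rw [exponentMeasure, ae_map_iff (hZ.measurable_shift t).aemeasurable hm]
  exact ae_of_all _ fun q => EReal.add_ne_top (EReal.coe_ne_top _) (hZ.ne_top _ _)

variable [IsProbabilityMeasure P]

/-- The points with positive `i₀`-th component have mass `E e^{Z(t i₀)} = 1`. -/
lemma IsSpectralProcess.exponentMeasure_pos (hZ : IsSpectralProcess P Z) (t : ι → T) (i₀ : ι) :
    exponentMeasure P Z t {v | 0 < v i₀} = 1 := by
  simpa using hZ.exponentMeasure_lt t i₀ 0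

lemma IsSpectralProcess.exponentMeasure_compl_box_zero_ne_zero (hZ : IsSpectralProcess P Z)
    (t : ι → T) (i₀ : ι) :
    exponentMeasure P Z t {v | ¬ ∀ k, v k ≤ ((0 : ι → ℝ) k : EReal)} ≠ 0 := fun h0 => by
  have := measure_mono (μ := exponentMeasure P Z t) (setOf_pos_subset i₀)
  rw [h0, hZ.exponentMeasure_pos] at this
  simp at this

variable [Fintype ι]

lemma IsSpectralProcess.isProbabilityMeasure_paretoMeasure (hZ : IsSpectralProcess P Z)
    (t : ι → T) (i₀ : ι) : IsProbabilityMeasure (paretoMeasure P Z t) :=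
  cond_isProbabilityMeasure_of_finite (hZ.exponentMeasure_compl_box_zero_ne_zero t i₀)
    (hZ.exponentMeasure_compl_box_ne_top t 0)

/-- The generalised Pareto distribution function: with `H = e^{-V}` it equals
`(V(min(x, 0)) - V(x)) / V(0)`, and the numerator is the mass of the points of the box with upper
corner `x` that have a positive component. -/
lemma IsSpectralSystem.paretoMeasure_df (hZ : IsSpectralProcess P Z)
    (h : IsSpectralSystem P Z Q p Zs) (t : ι → T) (x : ι → ℝ) :
    (paretoMeasure P Z t).real {v | ∀ k, v k ≤ (x k : EReal)} =
      gpdDF (jointDF Q (maxProcess p Zs) t) x := by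
  have hbox : ∀ x : ι → ℝ, MeasurableSet {v : ι → EReal | ¬ ∀ k, v k ≤ (x k : EReal)} :=
    fun x => (measurableSet_box x).compl
  have hsplit : (exponentMeasure P Z t).real {v | ¬ ∀ k, v k ≤ ((min (x k) 0 : ℝ) : EReal)}
      = (exponentMeasure P Z t).real {v | ¬ ∀ k, v k ≤ (x k : EReal)}
        + (exponentMeasure P Z t).real ({v | ¬ ∀ k, v k ≤ ((0 : ι → ℝ) k : EReal)}
          ∩ {v | ∀ k, v k ≤ (x k : EReal)}) := by
    rw [← measureReal_union _ ((hbox 0).inter (measurableSet_box x))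
      (hZ.exponentMeasure_compl_box_ne_top t x)
      (measure_ne_top_of_subset Set.inter_subset_left (hZ.exponentMeasure_compl_box_ne_top t 0))]
    · congr 1
      ext v
      simp only [Set.mem_ofPred_eq, Set.mem_union, Set.mem_inter_iff,
        EReal.coe_strictMono.monotone.map_min, le_min_iff, forall_and, Pi.zero_apply]
      tauto
    · exact Set.disjoint_left.2 fun v hv hv' => hv hv'.2
  rw [paretoMeasure, measureReal_def, cond_apply (hbox 0), ENNReal.toReal_mul, ENNReal.toReal_inv,
    ← measureReal_def, ← measureReal_def, gpdDF]
  simp_rw [h.jointDF_eq hZ]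
  rw [← Real.exp_sub, Real.log_exp, Real.log_exp, hsplit]
  ring

lemma IsSpectralSystem.isGPDVector_paretoMeasure (hZ : IsSpectralProcess P Z)
    (h : IsSpectralSystem P Z Q p Zs) (t : ι → T) :
    IsGPDVector (paretoMeasure P Z t) (fun w => w) (jointDF Q (maxProcess p Zs) t) :=
  ⟨measurable_id, h.paretoMeasure_df hZ t⟩

/-- A generalised Pareto vector has the law `paretoMeasure`; in particular it has no mass at `+∞`
although its distribution function is prescribed at real arguments only. -/
lemma IsGPDVector.map_eq (hZ : IsSpectralProcess P Z) (h : IsSpectralSystem P Z Q p Zs)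
    (t : ι → T) (i₀ : ι) {Ω₂ : Type*} [MeasurableSpace Ω₂] {R : Measure Ω₂}
    [IsProbabilityMeasure R] {W : Ω₂ → ι → EReal}
    (hW : IsGPDVector R W (jointDF Q (maxProcess p Zs) t)) :
    R.map W = paretoMeasure P Z t := by
  have := hZ.isProbabilityMeasure_paretoMeasure t i₀
  have : IsProbabilityMeasure (R.map W) :=
    Measure.isProbabilityMeasure_map hW.measurable.aemeasurable
  refine ext_of_real_boxes (hZ.ae_paretoMeasure_ne_top t) fun x => ?_
  rw [Measure.map_apply hW.measurable (measurableSet_box x),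
    ← ENNReal.toReal_eq_toReal_iff' (measure_ne_top _ _) (measure_ne_top _ _)]
  exact (hW.df_eq x).trans (h.paretoMeasure_df hZ t x).symm

/-- The increments of a generalised Pareto vector, given that its `i₀`-th component is positive,
have the law of the tilted spectral process. -/
theorem IsGPDVector.map_cond_increments (hZ : IsSpectralProcess P Z)
    (h : IsSpectralSystem P Z Q p Zs) (t : ι → T) (i₀ : ι) {Ω₂ : Type*} [MeasurableSpace Ω₂]
    {R : Measure Ω₂} [IsProbabilityMeasure R] {W : Ω₂ → ι → EReal}
    (hW : IsGPDVector R W (jointDF Q (maxProcess p Zs) t)) :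
    (cond R {ω | 0 < W ω i₀}).map (fun ω k => W ω k - W ω i₀) =
      (tiltedSpectralLaw P Z (t i₀)).map (fun f k => f (t k)) := by
  have hpos : MeasurableSet {v : ι → EReal | 0 < v i₀} :=
    measurableSet_lt measurable_const (measurable_pi_apply i₀)
  have hS : MeasurableSet {v : ι → EReal | ¬ ∀ k, v k ≤ ((0 : ι → ℝ) k : EReal)} :=
    (measurableSet_box 0).compl
  have hinc : Measurable fun (v : ι → EReal) k => v k - v i₀ := measurable_increments id i₀
  have hR : ∀ {B : Set (ι → EReal)}, MeasurableSet B → B ⊆ {v | 0 < v i₀} →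
      R (W ⁻¹' B) = (exponentMeasure P Z t {v | ¬ ∀ k, v k ≤ ((0 : ι → ℝ) k : EReal)})⁻¹
        * exponentMeasure P Z t B := fun {B} hB hsub => by
    rw [← Measure.map_apply hW.measurable hB, hW.map_eq hZ h t i₀, paretoMeasure, cond_apply hS,
      Set.inter_eq_right.2 (hsub.trans (setOf_pos_subset i₀))]
  ext A hA
  have hAinc : MeasurableSet {v : ι → EReal | (fun k => v k - v i₀) ∈ A} := hinc hA
  have hWpos : MeasurableSet {ω | 0 < W ω i₀} := hW.measurable hpos
  have hWinc : Measurable fun ω k => W ω k - W ω i₀ := hinc.comp hW.measurable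
  rw [Measure.map_apply hWinc hA, cond_apply hWpos,
    ← hZ.exponentMeasure_inter_increments t i₀ hA]
  have e1 := hR hpos le_rfl
  have e2 := hR (hpos.inter hAinc) Set.inter_subset_left
  rw [hZ.exponentMeasure_pos, mul_one] at e1
  refine (congrArg₂ (fun a b : ℝ≥0∞ => a⁻¹ * b) e1 e2).trans ?_
  rw [inv_inv, ← mul_assoc, ENNReal.mul_inv_cancel
    (hZ.exponentMeasure_compl_box_zero_ne_zero t i₀) (hZ.exponentMeasure_compl_box_ne_top t 0),
    one_mul]

end Pareto

section Determination

variable {Ω Ω' Ω₃ Ω₄ T : Type*} [MeasurableSpace Ω] [MeasurableSpace Ω'] [MeasurableSpace Ω₃]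
  [MeasurableSpace Ω₄]
  {P : Measure Ω} [IsProbabilityMeasure P] {Z : Ω → T → EReal}
  {Q : Measure Ω'} [IsProbabilityMeasure Q] {p : ℕ → Ω' → ℝ} {Zs : ℕ → Ω' → T → EReal}
  {P' : Measure Ω₃} [IsProbabilityMeasure P'] {Y : Ω₃ → T → EReal}
  {Q' : Measure Ω₄} [IsProbabilityMeasure Q'] {p' : ℕ → Ω₄ → ℝ} {Ys : ℕ → Ω₄ → T → EReal}

/-- The law of `Ξ_h Z` is determined by the finite-dimensional distributions of `ζ_Z`. -/
theorem tiltedSpectralLaw_eq_of_sameFidis (hZ : IsSpectralProcess P Z)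
    (hZs : IsSpectralSystem P Z Q p Zs) (hY : IsSpectralProcess P' Y)
    (hYs : IsSpectralSystem P' Y Q' p' Ys)
    (hsame : SameFidis Q (maxProcess p Zs) Q' (maxProcess p' Ys)) (h : T) :
    tiltedSpectralLaw P Z h = tiltedSpectralLaw P' Y h := by
  have := hZ.isProbabilityMeasure_tiltedSpectralLaw h
  have := hY.isProbabilityMeasure_tiltedSpectralLaw h
  have hfin : ∀ (n : ℕ) (t : Fin (n + 1) → T), t 0 = h →
      (tiltedSpectralLaw P Z h).map (fun f k => f (t k)) =
        (tiltedSpectralLaw P' Y h).map (fun f k => f (t k)) := by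
    rintro n t rfl
    have hdf : jointDF Q (maxProcess p Zs) t = jointDF Q' (maxProcess p' Ys) t := by
      ext x
      exact congrArg ENNReal.toReal ((hsame (n + 1) t).measure_mem_eq (measurableSet_box x))
    have := hZ.isProbabilityMeasure_paretoMeasure t 0
    -- the same vector is generalised Pareto for both processes
    have hW := hZs.isGPDVector_paretoMeasure hZ t
    rw [← hW.map_cond_increments hZ hZs t 0]
    rw [hdf] at hW
    rw [hW.map_cond_increments hY hYs t 0]
  refine IsProjectiveLimit.unique
    (P := fun I : Finset T => (tiltedSpectralLaw P' Y h).map I.restrict) (fun I => ?_) (fun I => rfl)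
  -- the tuple consisting of `h` and the points of `I`
  let t : Fin (I.card + 1) → T := Fin.cons h fun k => (I.equivFin.symm k : T)
  let g : (Fin (I.card + 1) → EReal) → I → EReal := fun v i => v (I.equivFin i).succ
  have hg : Measurable g := measurable_pi_lambda _ fun i => measurable_pi_apply _
  have ht : Measurable fun (f : T → EReal) k => f (t k) :=
    measurable_pi_lambda _ fun k => measurable_pi_apply _
  have hcomp : (I.restrict : (T → EReal) → I → EReal) = g ∘ fun f k => f (t k) := by
    ext f i
    simp [g, t]
  beta_reduce
  rw [hcomp, ← Measure.map_map hg ht, ← Measure.map_map hg ht, hfin _ t rfl]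

end Determination

/-! ### Path integrals by random sampling -/

section Sampling

variable {T S : Type*} [MeasurableSpace T] [MeasurableSpace S]

/-- The law of large numbers for bounded functions of an i.i.d. sample. -/
lemma ae_limsup_average_eq (ν : Measure T) [IsProbabilityMeasure ν] {g : T → ℝ≥0∞}
    (hg : Measurable g) {m : ℝ≥0∞} (hm : m ≠ ∞) (hgm : ∀ u, g u ≤ m) :
    ∀ᵐ s ∂(Measure.infinitePi fun _ : ℕ => ν),
      limsup (fun n : ℕ => (∑ j ∈ Finset.range n, g (s j)) / n) atTop = ∫⁻ u, g u ∂ν := by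
  have hgtop : ∀ u, g u ≠ ∞ := fun u => ((hgm u).trans_lt hm.lt_top).ne
  have hgr : Measurable fun u => (g u).toReal := hg.ennreal_toReal
  have heval : ∀ j, MeasurePreserving (fun s : ℕ → T => s j) (Measure.infinitePi fun _ => ν) ν :=
    fun j => measurePreserving_eval_infinitePi _ j
  have hint : Integrable (fun u => (g u).toReal) ν :=
    Integrable.of_bound hgr.aestronglyMeasurable m.toReal (ae_of_all _ fun u => by
      rw [Real.norm_of_nonneg ENNReal.toReal_nonneg]
      exact ENNReal.toReal_mono hm (hgm u))
  have hlln := strong_law_ae_real (μ := Measure.infinitePi fun _ : ℕ => ν)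
    (fun j s => (g (s j)).toReal) ((heval 0).integrable_comp_of_integrable hint)
    (fun i j hij => (iIndepFun_infinitePi (P := fun _ : ℕ => ν)
      (X := fun _ u => (g u).toReal) fun _ => hgr).indepFun hij)
    (fun j => ⟨(hgr.comp (measurable_pi_apply j)).aemeasurable,
      (hgr.comp (measurable_pi_apply 0)).aemeasurable, by
        have h : ∀ j, (Measure.infinitePi fun _ : ℕ => ν).map (fun s => (g (s j)).toReal)
            = ν.map fun u => (g u).toReal := fun j => by
          have h1 := Measure.map_map (μ := Measure.infinitePi fun _ : ℕ => ν) hgr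
            (heval j).measurable
          rw [(heval j).map_eq] at h1
          exact h1.symm
        rw [h, h]⟩)
  have hmean : (Measure.infinitePi fun _ : ℕ => ν)[fun s => (g (s 0)).toReal]
      = (∫⁻ u, g u ∂ν).toReal := by
    rw [← integral_toReal hg.aemeasurable (ae_of_all _ fun u => (hgtop u).lt_top)]
    have := integral_map (measurable_pi_apply (X := fun _ : ℕ => T) 0).aemeasurable
      (μ := Measure.infinitePi fun _ : ℕ => ν) (f := fun u => (g u).toReal)
      hgr.aestronglyMeasurable
    rw [← this]
    exact congrArg (fun M => ∫ u, (g u).toReal ∂M) (heval 0).map_eq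
  have hfin : ∫⁻ u, g u ∂ν ≠ ∞ := by
    refine ((lintegral_mono hgm).trans_lt ?_).ne
    simpa using hm.lt_top
  filter_upwards [hlln] with s hs
  rw [hmean] at hs
  have h2 := (ENNReal.continuous_ofReal.tendsto _).comp hs
  rw [ENNReal.ofReal_toReal hfin] at h2
  refine Tendsto.limsup_eq (h2.congr' ?_)
  filter_upwards [eventually_gt_atTop 0] with n hn
  have hn' : (0 : ℝ) < n := by exact_mod_cast hn
  rw [Function.comp_apply, ENNReal.ofReal_div_of_pos hn', ENNReal.ofReal_natCast,
    ← ENNReal.toReal_sum fun j _ => hgtop _,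
    ENNReal.ofReal_toReal (ENNReal.sum_ne_top.2 fun j _ => hgtop _)]

/-- A functional of a path `f`, depending only on its values at the points `s 0, s 1, …`, that
recovers `∫ ρ e^f dν` if the points are a typical i.i.d. sample from `ν`. In contrast to the
integral it is measurable for the σ-field generated by the evaluation maps. The truncation at `m`
allows for infinite integrals. -/
noncomputable def sampledIntegral (ρ : T → ℝ≥0∞) (s : ℕ → T) (f : T → EReal) : ℝ≥0∞ :=
  ⨆ m : ℕ, limsup (fun n : ℕ =>
    (∑ j ∈ Finset.range n, min (ρ (s j) * EReal.exp (f (s j))) m) / n) atTop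

lemma measurable_sampledIntegral_comp {α : Type*} [MeasurableSpace α] {ρ : T → ℝ≥0∞}
    (hρ : Measurable ρ) {s : α → ℕ → T} (hs : Measurable s) {Y : α → T → EReal}
    (hY : ∀ j, Measurable fun a => Y a (s a j)) :
    Measurable fun a => sampledIntegral ρ (s a) (Y a) := by
  refine .iSup fun m => .limsup fun n => ?_
  refine Measurable.div_const (Finset.measurable_fun_sum _ fun j _ => ?_) _
  exact ((hρ.comp ((measurable_pi_apply j).comp hs)).mul (hY j).ereal_exp).min measurable_const

lemma measurable_sampledIntegral {ρ : T → ℝ≥0∞} (hρ : Measurable ρ) (s : ℕ → T) :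
    Measurable (sampledIntegral ρ s) :=
  measurable_sampledIntegral_comp hρ measurable_const fun j => measurable_pi_apply (s j)

lemma ae_sampledIntegral_eq (ν : Measure T) [IsProbabilityMeasure ν] {ρ : T → ℝ≥0∞}
    (hρ : Measurable ρ) {f : T → EReal} (hf : Measurable f) :
    ∀ᵐ s ∂(Measure.infinitePi fun _ : ℕ => ν),
      sampledIntegral ρ s f = ∫⁻ u, ρ u * EReal.exp (f u) ∂ν := by
  have hm : Measurable fun u => ρ u * EReal.exp (f u) := hρ.mul hf.ereal_exp
  have hall := ae_all_iff.2 fun m : ℕ => ae_limsup_average_eq ν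
    (hm.min (measurable_const (a := (m : ℝ≥0∞)))) (ENNReal.natCast_ne_top m)
    fun u => min_le_right _ _
  filter_upwards [hall] with s hs
  simp_rw [sampledIntegral, hs]
  rw [← lintegral_iSup (fun m => hm.min measurable_const)
    fun m n hmn u => min_le_min_left _ (by exact_mod_cast hmn)]
  refine lintegral_congr fun u => ?_
  have : (fun m : ℕ => min (ρ u * EReal.exp (f u)) (m : ℝ≥0∞))
      = fun m : ℕ => (ρ u * EReal.exp (f u)) ⊓ (m : ℝ≥0∞) := rfl
  rw [this, ← inf_iSup_eq, ENNReal.iSup_natCast, inf_top_eq]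

/-- For almost every sample, the sampled integral of a measurable process is almost surely its
path integral. -/
lemma ae_ae_sampledIntegral_eq (μ : Measure T) [SigmaFinite μ] (hμ : μ ≠ 0) (M : Measure S)
    [SFinite M] {Y : S → T → EReal} (hY : Measurable fun q : S × T => Y q.1 q.2) :
    ∀ᵐ s ∂(Measure.infinitePi fun _ : ℕ => μ.toFinite), ∀ᵐ y ∂M,
      sampledIntegral (μ.rnDeriv μ.toFinite) s (Y y) = ∫⁻ u, EReal.exp (Y y u) ∂μ := by
  have : NeZero μ := ⟨hμ⟩
  have hρ : Measurable (μ.rnDeriv μ.toFinite) := Measure.measurable_rnDeriv _ _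
  have hYy : ∀ y, Measurable (Y y) := fun y => hY.comp measurable_prodMk_left
  have hdens : ∀ y, ∫⁻ u, μ.rnDeriv μ.toFinite u * EReal.exp (Y y u) ∂μ.toFinite
      = ∫⁻ u, EReal.exp (Y y u) ∂μ := fun y =>
    lintegral_rnDeriv_mul (absolutelyContinuous_toFinite μ) (hYy y).ereal_exp.aemeasurable
  have hI : Measurable fun y => ∫⁻ u, EReal.exp (Y y u) ∂μ := hY.ereal_exp.lintegral_prod_right'
  refine (Measure.ae_ae_comm ?_).2 (ae_of_all _ fun y => ?_)
  · refine measurableSet_eq_fun (measurable_sampledIntegral_comp hρ measurable_fst fun j => ?_)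
      (hI.comp measurable_snd)
    exact hY.comp (measurable_snd.prodMk ((measurable_pi_apply j).comp measurable_fst))
  · rw [← hdens y]
    exact ae_sampledIntegral_eq _ hρ (hYy y)

end Sampling

/-! ### The Dieker-Mikosch representation -/

section DiekerMikosch

variable {T Ω Ω' Ω₅ : Type*} [MeasurableSpace T] [MeasurableSpace Ω] [MeasurableSpace Ω']
  [MeasurableSpace Ω₅] {P : Measure Ω} {Z : Ω → T → EReal}

lemma IsSpectralProcess.measurable_sub_prod (hZ : IsSpectralProcess P Z)
    (hjoint : Measurable fun q : Ω × T => Z q.1 q.2) :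
    Measurable fun (q : Ω × T) t => Z q.1 t - Z q.1 q.2 :=
  measurable_pi_lambda _ fun t =>
    measurable_ereal_sub ((hZ.measurable_eval t).comp measurable_fst) hjoint

/-- The laws of `Ξ_h Z` as a kernel in `h`. -/
noncomputable def tiltKernel [SFinite P] (hZ : IsSpectralProcess P Z)
    (hjoint : Measurable fun q : Ω × T => Z q.1 q.2) : Kernel T (T → EReal) where
  toFun := tiltedSpectralLaw P Z
  measurable' := by
    refine Measure.measurable_of_measurable_coe _ fun A hA => ?_
    simp_rw [hZ.tiltedSpectralLaw_apply _ hA]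
    have hm : Measurable fun q : T × Ω =>
        {q : T × Ω | (fun t => Z q.2 t - Z q.2 q.1) ∈ A}.indicator
          (fun q => EReal.exp (Z q.2 q.1)) q :=
      (hjoint.comp measurable_swap).ereal_exp.indicator
        (((hZ.measurable_sub_prod hjoint).comp measurable_swap) hA)
    exact hm.lintegral_prod_right'

lemma isMarkovKernel_tiltKernel [SFinite P] (hZ : IsSpectralProcess P Z)
    (hjoint : Measurable fun q : Ω × T => Z q.1 q.2) : IsMarkovKernel (tiltKernel hZ hjoint) :=
  ⟨hZ.isProbabilityMeasure_tiltedSpectralLaw⟩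

lemma IsTiltedSystem.isMarking [SFinite P] (hZ : IsSpectralProcess P Z)
    (hjoint : Measurable fun q : Ω × T => Z q.1 q.2) {μ : Measure T} {R : Measure Ω₅}
    {q : ℕ → Ω₅ → ℝ} {τ : ℕ → Ω₅ → T} {X : ℕ → Ω₅ → T → EReal}
    (h : IsTiltedSystem P Z μ R q τ X) :
    IsMarking R (fun i ω => (q i ω, τ i ω))
      ((tiltKernel hZ hjoint).comap (Prod.snd : ℝ × T → T) measurable_snd) X where
  measurable_points := h.poisson.measurable
  measurable_marks i := measurable_pi_lambda _ fun _ =>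
    (h.measurable_marks i).comp (measurable_id.prodMk measurable_const)
  conditional_law := h.conditional_law

lemma ereal_add_sub_sub_sub (p z l : ℝ) (a : EReal) :
    (p : EReal) + (a - z) - ((l - z : ℝ) : EReal) = ((p - l : ℝ) : EReal) + a := by
  induction a with
  | bot => simp
  | top => rw [EReal.top_sub_coe, EReal.coe_add_top, EReal.top_sub_coe, EReal.coe_add_top]
  | coe a =>
    norm_cast
    ring

/-- For a single path `f` and `h` with `f h` finite, integrating over the height `p` turns the
normalised increments `f - f h - ln ∫ e^{f - f h} dμ` back into `f`, up to the factor
`1 / ∫ e^f dμ`. -/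
lemma gumbelIntensity_normalised {ι : Type*} [Countable ι] (μ : Measure T) {f : T → EReal}
    (hf : Measurable f) {h : T} (hbot : f h ≠ ⊥) (htop : f h ≠ ⊤)
    (hI0 : ∫⁻ u, EReal.exp (f u) ∂μ ≠ 0) (hI : ∫⁻ u, EReal.exp (f u) ∂μ ≠ ∞) (t : ι → T)
    (x : ι → ℝ) :
    gumbelIntensity {p : ℝ | ¬ ∀ k, (p : EReal) + (f (t k) - f h)
      - ENNReal.log (∫⁻ u, EReal.exp (f u - f h) ∂μ) ≤ (x k : EReal)} =
    (∫⁻ u, EReal.exp (f u) ∂μ)⁻¹ *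
      gumbelIntensity {p : ℝ | ¬ ∀ k, (p : EReal) + f (t k) ≤ (x k : EReal)} := by
  obtain ⟨z, hz⟩ : ∃ z : ℝ, f h = z := ⟨_, (EReal.coe_toReal htop hbot).symm⟩
  obtain ⟨l, hl⟩ : ∃ l : ℝ, ∫⁻ u, EReal.exp (f u) ∂μ = EReal.exp l := by
    have h1 : ENNReal.log (∫⁻ u, EReal.exp (f u) ∂μ) ≠ ⊤ := by simpa using hI
    have h2 : ENNReal.log (∫⁻ u, EReal.exp (f u) ∂μ) ≠ ⊥ := by simpa using hI0
    exact ⟨_, by rw [EReal.coe_toReal h1 h2, ENNReal.exp_log]⟩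
  have hlog : ENNReal.log (∫⁻ u, EReal.exp (f u - f h) ∂μ) = ((l - z : ℝ) : EReal) := by
    have : ∫⁻ u, EReal.exp (f u - f h) ∂μ = EReal.exp ((l - z : ℝ) : EReal) := by
      rw [EReal.coe_sub, sub_eq_add_neg, EReal.exp_add, ← hl, hz,
        ← lintegral_mul_const _ hf.ereal_exp]
      simp_rw [sub_eq_add_neg, EReal.exp_add]
    rw [this, EReal.log_exp]
  have hA : MeasurableSet {p : ℝ | ¬ ∀ k, (p : EReal) + f (t k) ≤ (x k : EReal)} := by
    have hm : Measurable fun (p : ℝ) k => (p : EReal) + f (t k) :=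
      measurable_pi_lambda _ fun k => measurable_coe_real_ereal.add measurable_const
    exact (hm (measurableSet_box x)).compl
  have hinv : (EReal.exp (l : EReal))⁻¹ = ENNReal.ofReal (Real.exp (-l)) := by
    rw [← EReal.exp_neg, ← EReal.coe_neg, EReal.exp_coe]
  rw [hlog, hl, hinv, ← gumbelIntensity_preimage_sub hA, hz]
  simp_rw [ereal_add_sub_sub_sub]
  rfl

variable {μ : Measure T} [SigmaFinite μ] {R : Measure Ω₅} {q : ℕ → Ω₅ → ℝ} {τ : ℕ → Ω₅ → T}
  {X : ℕ → Ω₅ → T → EReal}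

lemma IsTiltedSystem.measurable_diekerMikoschProcess_apply (h : IsTiltedSystem P Z μ R q τ X)
    (t : T) :
    Measurable fun ω => diekerMikoschProcess μ q X ω t :=
  .iSup fun i => measurable_ereal_sub
    ((measurable_coe_real_ereal.comp (measurable_fst.comp (h.poisson.measurable i))).add
      ((h.measurable_marks i).comp (measurable_id.prodMk measurable_const)))
    (h.measurable_marks i).ereal_exp.lintegral_prod_right'.ennreal_log

variable [IsProbabilityMeasure P] {Q : Measure Ω'} [IsProbabilityMeasure Q] {p : ℕ → Ω' → ℝ}
  {Zs : ℕ → Ω' → T → EReal} [IsProbabilityMeasure R]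

/-- The tilted points, normalised by a functional `Φ` that computes `∫ e^f dμ` along almost all
paths `f = Z - Z(h)`, have the same exponent measure as the points `P_i + Z_i`. -/
lemma IsSpectralProcess.lintegral_tilted_normalised {ι : Type*} [Countable ι]
    (hZ : IsSpectralProcess P Z) (hjoint : Measurable fun q : Ω × T => Z q.1 q.2)
    (hbot : ∀ h, ∀ᵐ ω ∂P, Z ω h ≠ ⊥) (hμ : μ ≠ 0)
    (hfin : ∀ᵐ ω ∂P, ∫⁻ s, EReal.exp (Z ω s) ∂μ < ∞) {Φ : (T → EReal) → ℝ≥0∞}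
    (hΦ : Measurable Φ) (hΦZ : ∀ᵐ y ∂P.prod μ,
      Φ (fun t => Z y.1 t - Z y.1 y.2) = ∫⁻ u, EReal.exp (Z y.1 u - Z y.1 y.2) ∂μ)
    (t : ι → T) (x : ι → ℝ) :
    ∫⁻ e, tiltedSpectralLaw P Z e.2
        {f | ¬ ∀ k, (e.1 : EReal) + f (t k) - ENNReal.log (Φ f) ≤ (x k : EReal)}
        ∂(gumbelIntensity.prod μ) =
      exponentMeasure P Z t {v | ¬ ∀ k, v k ≤ (x k : EReal)} := by
  let M : Set (ℝ × (T → EReal)) :=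
    {q | ¬ ∀ k, (q.1 : EReal) + q.2 (t k) - ENNReal.log (Φ q.2) ≤ (x k : EReal)}
  have hM : MeasurableSet M := by
    have hm : Measurable fun (q : ℝ × (T → EReal)) k =>
        (q.1 : EReal) + q.2 (t k) - ENNReal.log (Φ q.2) :=
      measurable_pi_lambda _ fun k => measurable_ereal_sub
        ((measurable_coe_real_ereal.comp measurable_fst).add
          ((measurable_pi_apply (t k)).comp measurable_snd))
        (hΦ.comp measurable_snd).ennreal_log
    exact (hm (measurableSet_box x)).compl
  have hpath : ∀ ω, Measurable (Z ω) := fun ω => hjoint.comp measurable_prodMk_left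
  have hbot' : ∀ᵐ y ∂P.prod μ, Z y.1 y.2 ≠ ⊥ := by
    have hm : MeasurableSet {y : Ω × T | Z y.1 y.2 ≠ ⊥} := hjoint (measurableSet_singleton ⊥).compl
    rw [Measure.ae_prod_iff_ae_ae hm, Measure.ae_ae_comm hm]
    exact ae_of_all _ hbot
  have hI0 : ∀ᵐ ω ∂P, ∫⁻ u, EReal.exp (Z ω u) ∂μ ≠ 0 := by
    have : NeZero μ := ⟨hμ⟩
    filter_upwards [Measure.ae_ae_of_ae_prod hbot'] with ω hω h0
    rw [lintegral_eq_zero_iff (hpath _).ereal_exp] at h0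
    obtain ⟨u, hu, hu'⟩ := (hω.and h0).exists
    exact hu (by simpa using hu')
  have hI : ∀ᵐ y ∂P.prod μ, ∫⁻ u, EReal.exp (Z y.1 u) ∂μ ≠ 0 ∧ ∫⁻ u, EReal.exp (Z y.1 u) ∂μ ≠ ∞ :=
    Measure.quasiMeasurePreserving_fst.ae (hI0.and (hfin.mono fun _ h => h.ne))
  have hIm : Measurable fun ω => ∫⁻ u, EReal.exp (Z ω u) ∂μ :=
    hjoint.ereal_exp.lintegral_prod_right'
  have hg : Measurable fun ω =>
      gumbelIntensity {p : ℝ | ¬ ∀ k, (p : EReal) + Z ω (t k) ≤ (x k : EReal)} :=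
    measurable_measure_prodMk_right ((hZ.measurable_shift t) (measurableSet_box x).compl)
  have hG : Measurable fun y : Ω × T => EReal.exp (Z y.1 y.2) *
      gumbelIntensity {p | (p, fun t => Z y.1 t - Z y.1 y.2) ∈ M} :=
    hjoint.ereal_exp.mul ((measurable_measure_prodMk_right hM).comp (hZ.measurable_sub_prod hjoint))
  have hk : Measurable fun e : ℝ × T => tiltedSpectralLaw P Z e.2 {f | (e.1, f) ∈ M} := by
    have := isMarkovKernel_tiltKernel hZ hjoint
    have hM' : MeasurableSet {r : (ℝ × T) × (T → EReal) | (r.1.1, r.2) ∈ M} :=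
      hM.preimage (by fun_prop)
    exact Kernel.measurable_kernel_prodMk_left
      (κ := (tiltKernel hZ hjoint).comap (Prod.snd : ℝ × T → T) measurable_snd) hM'
  calc ∫⁻ e, tiltedSpectralLaw P Z e.2 {f | (e.1, f) ∈ M} ∂(gumbelIntensity.prod μ)
      = ∫⁻ h, ∫⁻ p, tiltedSpectralLaw P Z h {f | (p, f) ∈ M} ∂gumbelIntensity ∂μ :=
        lintegral_prod_symm' _ hk
    _ = ∫⁻ h, ∫⁻ ω, EReal.exp (Z ω h) *
          gumbelIntensity {p | (p, fun t => Z ω t - Z ω h) ∈ M} ∂P ∂μ := by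
        simp_rw [hZ.lintegral_tiltedSpectralLaw _ hM]
    _ = ∫⁻ y, EReal.exp (Z y.1 y.2) *
          gumbelIntensity {p | (p, fun t => Z y.1 t - Z y.1 y.2) ∈ M} ∂(P.prod μ) :=
        (lintegral_prod_symm' _ hG).symm
    _ = ∫⁻ y, EReal.exp (Z y.1 y.2) * ((∫⁻ u, EReal.exp (Z y.1 u) ∂μ)⁻¹ *
          gumbelIntensity {p : ℝ | ¬ ∀ k, (p : EReal) + Z y.1 (t k) ≤ (x k : EReal)})
          ∂(P.prod μ) := by
        refine lintegral_congr_ae ?_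
        filter_upwards [hbot', hI, hΦZ] with y hy1 hy2 hy3
        rw [← gumbelIntensity_normalised μ (hpath _) hy1
          (hZ.ne_top _ _) hy2.1 hy2.2, ← hy3]
        rfl
    _ = ∫⁻ ω, ∫⁻ h, EReal.exp (Z ω h) * ((∫⁻ u, EReal.exp (Z ω u) ∂μ)⁻¹ *
          gumbelIntensity {p : ℝ | ¬ ∀ k, (p : EReal) + Z ω (t k) ≤ (x k : EReal)}) ∂μ ∂P :=
        lintegral_prod _ (hjoint.ereal_exp.mul
          ((hIm.inv.comp measurable_fst).mul (hg.comp measurable_fst))).aemeasurable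
    _ = ∫⁻ ω, gumbelIntensity {p : ℝ | ¬ ∀ k, (p : EReal) + Z ω (t k) ≤ (x k : EReal)} ∂P := by
        refine lintegral_congr_ae ?_
        filter_upwards [hI0, hfin] with ω h0 h1
        rw [lintegral_mul_const _ (hpath _).ereal_exp, ← mul_assoc,
          ENNReal.mul_inv_cancel h0 h1.ne, one_mul]
    _ = exponentMeasure P Z t {v | ¬ ∀ k, v k ≤ (x k : EReal)} :=
        (hZ.exponentMeasure_apply t (measurableSet_box x).compl).symm

/-- The finite-dimensional distribution functions of the Dieker-Mikosch process. -/
lemma IsTiltedSystem.measure_le {ι : Type*} [Countable ι]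
    (hZ : IsSpectralProcess P Z) (hjoint : Measurable fun q : Ω × T => Z q.1 q.2)
    (hbot : ∀ h, ∀ᵐ ω ∂P, Z ω h ≠ ⊥) (hμ : μ ≠ 0)
    (hfin : ∀ᵐ ω ∂P, ∫⁻ s, EReal.exp (Z ω s) ∂μ < ∞) (h : IsTiltedSystem P Z μ R q τ X)
    (t : ι → T) (x : ι → ℝ) :
    R {ω | ∀ k, diekerMikoschProcess μ q X ω (t k) ≤ (x k : EReal)} =
      expNeg (exponentMeasure P Z t {v | ¬ ∀ k, v k ≤ (x k : EReal)}) := by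
  have : NeZero μ := ⟨hμ⟩
  -- one sample of points that computes the path integrals of all processes involved
  obtain ⟨s, hsX, hsZ⟩ := ((ae_all_iff.2 fun i =>
    ae_ae_sampledIntegral_eq μ hμ R (h.measurable_marks i)).and
    (ae_ae_sampledIntegral_eq μ hμ (P.prod μ)
      (Y := fun y t => Z y.1 t - Z y.1 y.2) (measurable_ereal_sub
        (hjoint.comp ((measurable_fst.comp measurable_fst).prodMk measurable_snd))
        (hjoint.comp measurable_fst)))).exists
  set Φ := sampledIntegral (μ.rnDeriv μ.toFinite) s
  have hΦ : Measurable Φ := measurable_sampledIntegral (Measure.measurable_rnDeriv _ _) s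
  let D : Set ((ℝ × T) × (T → EReal)) :=
    {r | ∀ k, (r.1.1 : EReal) + r.2 (t k) - ENNReal.log (Φ r.2) ≤ (x k : EReal)}
  have hD : MeasurableSet D := by
    have hm : Measurable fun (r : (ℝ × T) × (T → EReal)) k =>
        (r.1.1 : EReal) + r.2 (t k) - ENNReal.log (Φ r.2) :=
      measurable_pi_lambda _ fun k => measurable_ereal_sub
        ((measurable_coe_real_ereal.comp (measurable_fst.comp measurable_fst)).add
          ((measurable_pi_apply (t k)).comp measurable_snd))
        (hΦ.comp measurable_snd).ennreal_log
    exact hm (measurableSet_box x)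
  have hset : {ω | ∀ k, diekerMikoschProcess μ q X ω (t k) ≤ (x k : EReal)}
      =ᵐ[R] {ω | ∀ i, ((q i ω, τ i ω), X i ω) ∈ D} := by
    filter_upwards [ae_all_iff.2 hsX] with ω hω
    refine propext ?_
    change (∀ k, diekerMikoschProcess μ q X ω (t k) ≤ (x k : EReal)) ↔ _
    simp only [diekerMikoschProcess, iSup_le_iff, ← hω]
    exact forall_comm
  have := isMarkovKernel_tiltKernel hZ hjoint
  rw [measure_congr hset, (h.isMarking hZ hjoint).measure_forall h.poisson hD,
    ← hZ.lintegral_tilted_normalised hjoint hbot hμ hfin hΦ hsZ t x]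
  rfl

/-- The Dieker-Mikosch representation of `ζ_Z`. -/
theorem sameFidis_diekerMikoschProcess (hZ : IsSpectralProcess P Z)
    (hsys : IsSpectralSystem P Z Q p Zs) (hjoint : Measurable fun q : Ω × T => Z q.1 q.2)
    (hbot : ∀ h, ∀ᵐ ω ∂P, Z ω h ≠ ⊥) (hμ : μ ≠ 0)
    (hfin : ∀ᵐ ω ∂P, ∫⁻ s, EReal.exp (Z ω s) ∂μ < ∞) (h : IsTiltedSystem P Z μ R q τ X) :
    SameFidis Q (maxProcess p Zs) R (diekerMikoschProcess μ q X) := by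
  intro n t
  have hmax : Measurable fun ω k => maxProcess p Zs ω (t k) :=
    measurable_pi_lambda _ fun k => hsys.measurable_maxProcess_apply _
  have hDM : Measurable fun ω k => diekerMikoschProcess μ q X ω (t k) :=
    measurable_pi_lambda _ fun k => h.measurable_diekerMikoschProcess_apply _
  refine ⟨hmax.aemeasurable, hDM.aemeasurable, ?_⟩
  have := Measure.isProbabilityMeasure_map hmax.aemeasurable (μ := Q)
  have := Measure.isProbabilityMeasure_map hDM.aemeasurable (μ := R)
  refine (ext_of_real_boxes ?_ fun x => ?_).symm
  · rw [ae_map_iff hmax.aemeasurable]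
    · exact ae_all_iff.2 fun k => hsys.ae_maxProcess_ne_top hZ _
    · simp_rw [Set.ofPred_forall]
      exact .iInter fun k => (measurable_pi_apply k) (measurableSet_singleton ⊤).compl
  · rw [Measure.map_apply hDM (measurableSet_box x), Measure.map_apply hmax (measurableSet_box x)]
    exact (h.measure_le hZ hjoint hbot hμ hfin t x).trans (hsys.measure_le hZ t x).symm

end DiekerMikosch

end MaxStable

theorem theorem2p2 {T Ω Ω₁ : Type*} [MeasurableSpace T] [MeasurableSpace Ω] [MeasurableSpace Ω₁]
    (P : Measure Ω) [IsProbabilityMeasure P] (Z : Ω → T → EReal)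
    (hZ : MaxStable.IsSpectralProcess P Z)
    (Q : Measure Ω₁) [IsProbabilityMeasure Q] (p : ℕ → Ω₁ → ℝ) (Zs : ℕ → Ω₁ → T → EReal)
    (hsys : MaxStable.IsSpectralSystem P Z Q p Zs) :
    -- (i) the generalised Pareto distribution function is one, and the fidis of `Ξ_h Z` are those
    -- of `W^{(h)} - W_1^{(h)}`, where `t 0 = h`
    (∀ h : T, (∀ᵐ ω ∂P, Z ω h ≠ ⊥) →
      ∀ (n : ℕ) (t : Fin (n + 1) → T), Function.Injective t → t 0 = h →
        (∃ ν : Measure (Fin (n + 1) → EReal), IsProbabilityMeasure ν ∧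
          MaxStable.IsGPDVector ν (fun w => w)
            (MaxStable.jointDF Q (MaxStable.maxProcess p Zs) t)) ∧
        ∀ {Ω₂ : Type*} [MeasurableSpace Ω₂] (R : Measure Ω₂) [IsProbabilityMeasure R]
          (W : Ω₂ → Fin (n + 1) → EReal),
          MaxStable.IsGPDVector R W (MaxStable.jointDF Q (MaxStable.maxProcess p Zs) t) →
          IdentDistrib
            (fun (f : T → EReal) (k : Fin n) => f (t k.succ))
            (fun (ω : Ω₂) (k : Fin n) => W ω k.succ - W ω 0)
            (MaxStable.tiltedSpectralLaw P Z h) (ProbabilityTheory.cond R {ω | 0 < W ω 0})) ∧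
    -- the law of `Ξ_h Z` is determined by `ζ_Z`
    (∀ h : T, (∀ᵐ ω ∂P, Z ω h ≠ ⊥) →
      ∀ {Ω₃ Ω₄ : Type*} [MeasurableSpace Ω₃] [MeasurableSpace Ω₄]
        (P' : Measure Ω₃) [IsProbabilityMeasure P'] (Y : Ω₃ → T → EReal)
        (Q' : Measure Ω₄) [IsProbabilityMeasure Q'] (p' : ℕ → Ω₄ → ℝ) (Ys : ℕ → Ω₄ → T → EReal),
        MaxStable.IsSpectralProcess P' Y → MaxStable.IsSpectralSystem P' Y Q' p' Ys →
        (∀ᵐ ω ∂P', Y ω h ≠ ⊥) →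
        MaxStable.SameFidis Q (MaxStable.maxProcess p Zs) Q' (MaxStable.maxProcess p' Ys) →
        MaxStable.tiltedSpectralLaw P Z h = MaxStable.tiltedSpectralLaw P' Y h) ∧
    -- (ii) the Dieker-Mikosch representation
    ((∀ h : T, ∀ᵐ ω ∂P, Z ω h ≠ ⊥) → Measurable (fun q : Ω × T => Z q.1 q.2) →
      ∀ (μ : Measure T) [SigmaFinite μ], μ ≠ 0 →
        (∀ᵐ ω ∂P, ∫⁻ s, EReal.exp (Z ω s) ∂μ < ∞) →
        ∀ {Ω₅ : Type*} [MeasurableSpace Ω₅] (R : Measure Ω₅) [IsProbabilityMeasure R]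
          (q : ℕ → Ω₅ → ℝ) (τ : ℕ → Ω₅ → T) (X : ℕ → Ω₅ → T → EReal),
          MaxStable.IsTiltedSystem P Z μ R q τ X →
          MaxStable.SameFidis Q (MaxStable.maxProcess p Zs) R
            (MaxStable.diekerMikoschProcess μ q X)) := by
  refine ⟨?_, ?_, ?_⟩
  · rintro h - n t - rfl
    refine ⟨⟨MaxStable.paretoMeasure P Z t, hZ.isProbabilityMeasure_paretoMeasure t 0,
      hsys.isGPDVector_paretoMeasure hZ t⟩, ?_⟩
    intro Ω₂ _ R _ W hW
    have htail : Measurable fun (v : Fin (n + 1) → EReal) (k : Fin n) => v k.succ :=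
      measurable_pi_lambda _ fun k => measurable_pi_apply _
    have hpath : Measurable fun (f : T → EReal) k => f (t k) :=
      measurable_pi_lambda _ fun k => measurable_pi_apply _
    have hinc : Measurable fun ω k => W ω k - W ω 0 :=
      (MaxStable.measurable_increments id 0).comp hW.measurable
    refine ⟨(htail.comp hpath).aemeasurable, (htail.comp hinc).aemeasurable, ?_⟩
    have := congrArg (Measure.map fun (v : Fin (n + 1) → EReal) (k : Fin n) => v k.succ)
      (hW.map_cond_increments hZ hsys t 0)
    rw [Measure.map_map htail hinc, Measure.map_map htail hpath] at this
    exact this.symm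
  · intro h _ Ω₃ Ω₄ _ _ P' _ Y Q' _ p' Ys hY hYs _ hsame
    exact MaxStable.tiltedSpectralLaw_eq_of_sameFidis hZ hsys hY hYs hsame h
  · intro hbot hjoint μ _ hμ hfin Ω₅ _ R _ q τ X hX
    exact MaxStable.sameFidis_diekerMikoschProcess hZ hsys hjoint hbot hμ hfin hX
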